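/- An instance of the node-weighted diameter-optimal augmentation problem (WDOAP) consists of: a path $P=(v_1,\dots,v_N)$, $N\ge 2$, with a weight $\delta(v_i,v_{i+1})>0$ on each edge; a weight $w(v_i)$ with $0\le w(v_i)\le\min\{d(v_1,v_i),d(v_i,v_N)\}$ on each vertex, where $d$ denotes the distance in $P$; and a symmetric function $c:V(P)^2\to\mathbb{R}_{\ge 0}$ (the shortcut weights) that is a graph-metric, i.e. $c(u,v)\le c(u,z)+d(z,v)$ for any three distinct vertices $u,v,z$. The function $c$ can be accessed only through an oracle, which reports $c(u,v)$ for a queried pair in constant time. For $1\le i<j\le N$ let $d_{i,j}$ be the distance in the multigraph obtained from $P$ by adding an edge $(v_i,v_j)$ of weight $c(v_i,v_j)$, and let $$D(i,j)=\max_{1\le k<h\le N}\bigl\{w(v_k)+d_{i,j}(v_k,v_h)+w(v_h)\bigr\}.$$ A $(1+\varepsilon)$-approximate solution is a pair $i<j$ with $D(i,j)\le(1+\varepsilon)\,D(i',j')$ for all $1\le i'<j'\le N$. **Theorem.** There is an algorithm that, given $\varepsilon>0$ and an instance of WDOAP with $N$ vertices, computes a $(1+\varepsilon)$-approximate solution in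 $O\!\left(N+\frac1\varepsilon\log\frac1\varepsilon\right)$ time and $O\!\left(N+\frac1\varepsilon\right)$ space. Here an algorithm is a single program (independent of $N$, $\varepsilon$ and the instance) for a real RAM with an oracle for $c$: exact real arithmetic $+,-,\times,/$ and comparisons, addition, truncated subtraction and comparison of integers, array accesses and oracle queries at unit cost, no rounding of reals to integers. The program uses finitely many registers and arrays, and there is an absolute constant $K$ such that, for every instance and every $\varepsilon>0$, it halts after at most $K\left(N+\frac1\varepsilon\log\frac1\varepsilon\right)$ steps while using at most $\left\lfloor K\left(N+\frac1\varepsilon\right)\right\rfloor$ cells of each array and integers not exceeding this number. -/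

import Mathlib

/-! ## Weighted multigraphs and distances -/

/-- `WalkLength E u v x`: some walk from `u` to `v` has length `x`, in the multigraph in which
`E a b y` says that `a` and `b` are joined by an edge of weight `y`. -/
inductive WalkLength {V : Type} (E : V → V → ℝ → Prop) : V → V → ℝ → Prop
  | nil (u : V) : WalkLength E u u 0
  | cons {u v z : V} {x y : ℝ} : E u v x → WalkLength E v z y → WalkLength E u z (x + y)

/-- The distance between two vertices: the length of a shortest walk. In the graphs below all edge
weights are nonnegative and any two vertices are joined by a walk. -/
noncomputable def graphDist {V : Type} (E : V → V → ℝ → Prop) (u v : V) : ℝ :=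
  sInf {x : ℝ | WalkLength E u v x}

/-- The edges of the path on the vertices `0, 1, …, n`; its `k`-th edge joins `k` and `k + 1` and
has weight `δ k`. -/
def pathEdge {n : ℕ} (δ : Fin n → ℝ) (u v : Fin (n + 1)) (x : ℝ) : Prop :=
  ∃ k : Fin n, x = δ k ∧
    ((u = k.castSucc ∧ v = k.succ) ∨ (u = k.succ ∧ v = k.castSucc))

/-- The edges of the multigraph `G + (i, j)`, where the new edge `(i, j)` has weight `a`. -/
def addEdge {V : Type} (E : V → V → ℝ → Prop) (i j : V) (a : ℝ) (u v : V) (x : ℝ) : Prop :=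
  E u v x ∨ (x = a ∧ ((u = i ∧ v = j) ∨ (u = j ∧ v = i)))

/-! ## The problem -/

/-- An instance of the node-weighted diameter-optimal augmentation problem. The path has `n + 1`
vertices `0, …, n`. -/
structure WDoap where
  /-- the number of edges of the path -/
  n : ℕ
  one_le_n : 1 ≤ n
  /-- edge weights -/
  δ : Fin n → ℝ
  δ_pos : ∀ k, 0 < δ k
  /-- node weights -/
  w : Fin (n + 1) → ℝ
  w_nonneg : ∀ v, 0 ≤ w v
  w_le : ∀ v, w v ≤ min (graphDist (pathEdge δ) 0 v) (graphDist (pathEdge δ) v (Fin.last n))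
  /-- shortcut weights -/
  c : Fin (n + 1) → Fin (n + 1) → ℝ
  c_nonneg : ∀ u v, 0 ≤ c u v
  c_symm : ∀ u v, c u v = c v u
  graph_triangle : ∀ u v z, u ≠ v → u ≠ z → v ≠ z →
    c u v ≤ c u z + graphDist (pathEdge δ) z v

namespace WDoap

/-- The number of vertices of the path. -/
def N (I : WDoap) : ℕ := I.n + 1

/-- The distance `d_{i,j}(k, h)` in the path augmented by the shortcut `(i, j)`. -/
noncomputable def augDist (I : WDoap) (i j k h : Fin (I.n + 1)) : ℝ :=
  graphDist (addEdge (pathEdge I.δ) i j (I.c i j)) k h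

/-- All pairs of vertices `k < h`. -/
def pairs (I : WDoap) : Finset (Fin (I.n + 1) × Fin (I.n + 1)) :=
  Finset.univ.filter fun p => p.1 < p.2

theorem pairs_nonempty (I : WDoap) : I.pairs.Nonempty :=
  ⟨(0, Fin.last I.n), by
    have h := I.one_le_n
    simp only [pairs, Finset.mem_filter, Finset.mem_univ, true_and, Fin.lt_def, Fin.val_zero,
      Fin.val_last]
    omega⟩

/-- The objective function `D(i, j)`: the maximum over `k < h` of `w k + d_{i,j}(k, h) + w h`. -/
noncomputable def D (I : WDoap) (i j : Fin (I.n + 1)) : ℝ :=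
  I.pairs.sup' I.pairs_nonempty fun p => I.w p.1 + I.augDist i j p.1 p.2 + I.w p.2

/-- `(i, j)` is a `ρ`-approximate solution. -/
def IsApprox (I : WDoap) (ρ : ℝ) (i j : Fin (I.n + 1)) : Prop :=
  i < j ∧ ∀ i' j' : Fin (I.n + 1), i' < j' → I.D i j ≤ ρ * I.D i' j'

end WDoap

/-! ## The machine model: a real RAM with an oracle for the shortcut weights

Programs have finitely many integer and real registers, and finitely many integer and real arrays.
Reals admit the exact operations `+ - * /` and comparisons, with no rounding and no
conversion to integers. The machine has a parameter `S`: every array has `S` cells and every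
integer is a word with value at most `S`. A program that leaves these bounds, divides by zero, or
queries the oracle outside the vertex set has no run. -/

namespace RealRAM

/-- Integer expressions. -/
inductive NExpr
  | lit (a : ℕ)
  | reg (x : ℕ)
  | get (arr : ℕ) (idx : NExpr)
  | add (e f : NExpr)
  | sub (e f : NExpr)

/-- Real expressions; `oracle e f` queries the weight of the shortcut between `e` and `f`. -/
inductive RExpr
  | lit (a : ℕ)
  | reg (x : ℕ)
  | get (arr : ℕ) (idx : NExpr)
  | add (e f : RExpr)
  | sub (e f : RExpr)
  | mul (e f : RExpr)
  | div (e f : RExpr)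
  | oracle (e f : NExpr)

/-- Tests. The second argument of `and` is only evaluated if the first one holds. -/
inductive Test
  | natLe (e f : NExpr)
  | realLe (e f : RExpr)
  | not (b : Test)
  | and (a b : Test)

/-- Programs. -/
inductive Prog
  | nop
  | setNat (x : ℕ) (e : NExpr)
  | setReal (x : ℕ) (e : RExpr)
  | storeNat (arr : ℕ) (idx : NExpr) (e : NExpr)
  | storeReal (arr : ℕ) (idx : NExpr) (e : RExpr)
  | seq (p q : Prog)
  | cond (b : Test) (p q : Prog)
  | loop (b : Test) (p : Prog)

/-- Memory contents. -/
structure State where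
  natReg : ℕ → ℕ
  realReg : ℕ → ℝ
  natArr : ℕ → ℕ → ℕ
  realArr : ℕ → ℕ → ℝ

/-- Value of an integer expression; subtraction is truncated at `0`. -/
def NExpr.eval (s : State) : NExpr → ℕ
  | lit a => a
  | reg x => s.natReg x
  | get arr idx => s.natArr arr (idx.eval s)
  | add e f => e.eval s + f.eval s
  | sub e f => e.eval s - f.eval s

/-- All array accesses are within bounds and all intermediate values fit into a word. -/
def NExpr.Safe (S : ℕ) (s : State) : NExpr → Prop
  | lit a => a ≤ S
  | reg x => s.natReg x ≤ S
  | get arr idx => idx.Safe S s ∧ idx.eval s < S ∧ s.natArr arr (idx.eval s) ≤ S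
  | add e f => e.Safe S s ∧ f.Safe S s ∧ e.eval s + f.eval s ≤ S
  | sub e f => e.Safe S s ∧ f.Safe S s

/-- Number of steps for evaluating an integer expression: one per operation. -/
def NExpr.steps : NExpr → ℕ
  | lit _ => 1
  | reg _ => 1
  | get _ idx => idx.steps + 1
  | add e f => e.steps + f.steps + 1
  | sub e f => e.steps + f.steps + 1

/-- The oracle's answer. -/
noncomputable def answer (I : WDoap) (u v : ℕ) : ℝ :=
  if h : u < I.n + 1 ∧ v < I.n + 1 then I.c ⟨u, h.1⟩ ⟨v, h.2⟩ else 0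

/-- Value of a real expression. -/
noncomputable def RExpr.eval (I : WDoap) (s : State) : RExpr → ℝ
  | lit a => (a : ℝ)
  | reg x => s.realReg x
  | get arr idx => s.realArr arr (idx.eval s)
  | add e f => e.eval I s + f.eval I s
  | sub e f => e.eval I s - f.eval I s
  | mul e f => e.eval I s * f.eval I s
  | div e f => e.eval I s / f.eval I s
  | oracle e f => answer I (e.eval s) (f.eval s)

/-- Array accesses are within bounds, divisors are nonzero, queries are about vertices. -/
def RExpr.Safe (I : WDoap) (S : ℕ) (s : State) : RExpr → Prop
  | lit _ => True
  | reg _ => True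
  | get _ idx => idx.Safe S s ∧ idx.eval s < S
  | add e f => e.Safe I S s ∧ f.Safe I S s
  | sub e f => e.Safe I S s ∧ f.Safe I S s
  | mul e f => e.Safe I S s ∧ f.Safe I S s
  | div e f => e.Safe I S s ∧ f.Safe I S s ∧ f.eval I s ≠ 0
  | oracle e f => e.Safe S s ∧ f.Safe S s ∧ e.eval s < I.N ∧ f.eval s < I.N

/-- Number of steps for evaluating a real expression: one per operation or query. -/
def RExpr.steps : RExpr → ℕ
  | lit _ => 1
  | reg _ => 1
  | get _ idx => idx.steps + 1
  | add e f => e.steps + f.steps + 1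
  | sub e f => e.steps + f.steps + 1
  | mul e f => e.steps + f.steps + 1
  | div e f => e.steps + f.steps + 1
  | oracle e f => e.steps + f.steps + 1

/-- Truth value of a test. -/
def Test.Holds (I : WDoap) (s : State) : Test → Prop
  | natLe e f => e.eval s ≤ f.eval s
  | realLe e f => e.eval I s ≤ f.eval I s
  | not b => ¬ b.Holds I s
  | and a b => a.Holds I s ∧ b.Holds I s

/-- A test is safe if every expression that is evaluated is safe. -/
def Test.Safe (I : WDoap) (S : ℕ) (s : State) : Test → Prop
  | natLe e f => e.Safe S s ∧ f.Safe S s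
  | realLe e f => e.Safe I S s ∧ f.Safe I S s
  | not b => b.Safe I S s
  | and a b => a.Safe I S s ∧ (a.Holds I s → b.Safe I S s)

/-- Number of steps charged for a test. -/
def Test.steps : Test → ℕ
  | natLe e f => e.steps + f.steps + 1
  | realLe e f => e.steps + f.steps + 1
  | not b => b.steps + 1
  | and a b => a.steps + b.steps + 1

namespace State

/-- Assignment to an integer register. -/
def setNat (s : State) (x a : ℕ) : State :=
  { s with natReg := Function.update s.natReg x a }

/-- Assignment to a real register. -/
noncomputable def setReal (s : State) (x : ℕ) (a : ℝ) : State :=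
  { s with realReg := Function.update s.realReg x a }

/-- Assignment to a cell of an integer array. -/
def storeNat (s : State) (arr idx a : ℕ) : State :=
  { s with natArr := Function.update s.natArr arr (Function.update (s.natArr arr) idx a) }

/-- Assignment to a cell of a real array. -/
noncomputable def storeReal (s : State) (arr idx : ℕ) (a : ℝ) : State :=
  { s with realArr := Function.update s.realArr arr (Function.update (s.realArr arr) idx a) }

end State

/-- `Run I S p s s' t`: with oracle `I.c` and `S` cells per array, the program `p` started in `s`
halts in `s'` after `t` steps. -/
inductive Run (I : WDoap) (S : ℕ) : Prog → State → State → ℕ → Prop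
  | nop (s : State) : Run I S .nop s s 1
  | setNat (s : State) (x : ℕ) (e : NExpr) : e.Safe S s →
      Run I S (.setNat x e) s (s.setNat x (e.eval s)) (e.steps + 1)
  | setReal (s : State) (x : ℕ) (e : RExpr) : e.Safe I S s →
      Run I S (.setReal x e) s (s.setReal x (e.eval I s)) (e.steps + 1)
  | storeNat (s : State) (arr : ℕ) (idx e : NExpr) : idx.Safe S s → idx.eval s < S → e.Safe S s →
      Run I S (.storeNat arr idx e) s (s.storeNat arr (idx.eval s) (e.eval s))
        (idx.steps + e.steps + 1)
  | storeReal (s : State) (arr : ℕ) (idx : NExpr) (e : RExpr) :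
      idx.Safe S s → idx.eval s < S → e.Safe I S s →
      Run I S (.storeReal arr idx e) s (s.storeReal arr (idx.eval s) (e.eval I s))
        (idx.steps + e.steps + 1)
  | seq {p q : Prog} {s s' s'' : State} {t t' : ℕ} : Run I S p s s' t → Run I S q s' s'' t' →
      Run I S (.seq p q) s s'' (t + t')
  | condTrue {b : Test} {p : Prog} (q : Prog) {s s' : State} {t : ℕ} :
      b.Safe I S s → b.Holds I s → Run I S p s s' t →
      Run I S (.cond b p q) s s' (b.steps + t + 1)
  | condFalse {b : Test} (p : Prog) {q : Prog} {s s' : State} {t : ℕ} :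
      b.Safe I S s → ¬ b.Holds I s → Run I S q s s' t →
      Run I S (.cond b p q) s s' (b.steps + t + 1)
  | loopTrue {b : Test} {p : Prog} {s s' s'' : State} {t t' : ℕ} :
      b.Safe I S s → b.Holds I s → Run I S p s s' t → Run I S (.loop b p) s' s'' t' →
      Run I S (.loop b p) s s'' (b.steps + t + t' + 1)
  | loopFalse {b : Test} (p : Prog) {s : State} :
      b.Safe I S s → ¬ b.Holds I s → Run I S (.loop b p) s s (b.steps + 1)

/-- The initial memory: integer register `0` holds the number of vertices, real register `0` holds
`ε`, real array `0` holds the edge weights, real array `1` holds the node weights, and everything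
else is `0`. The shortcut weights are accessible only through the oracle. -/
noncomputable def input (I : WDoap) (ε : ℝ) : State where
  natReg x := if x = 0 then I.N else 0
  realReg x := if x = 0 then ε else 0
  natArr _ _ := 0
  realArr arr k :=
    if arr = 0 then (if h : k < I.n then I.δ ⟨k, h⟩ else 0)
    else if arr = 1 then (if h : k < I.n + 1 then I.w ⟨k, h⟩ else 0)
    else 0

/-- The program `p` solves the instance `I` of the problem up to a factor of `1 + ε` in at most
`T` steps and with at most `S` cells per array: it halts, and then integer registers `1` and `2`
hold the two end vertices of a `(1 + ε)`-approximate solution. The input must fit as well. -/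
def Solves (p : Prog) (I : WDoap) (ε T : ℝ) (S : ℕ) : Prop :=
  I.N ≤ S ∧ ∃ (s : State) (t : ℕ) (i j : Fin (I.n + 1)), Run I S p (input I ε) s t ∧ (t : ℝ) ≤ T ∧
    s.natReg 1 = i ∧ s.natReg 2 = j ∧ I.IsApprox (1 + ε) i j

end RealRAM

/-! ## Distances in a path with a shortcut -/

/-! Place the path on a line and give vertex `k` the interval of radius `nodeWt k` around `pos k`.
Then `D i j ≤ μ` says that any two intervals are within `μ`, measured between their far ends along
the path, or are joined by a short enough route through the shortcut (`D_le_iff`). Three facts make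
this decidable fast enough.

The optimum is known up to a constant. Apart from one edge, the whole path has length at most four
times the optimum (`DLe.exists_edge`). So bridging a longest edge is a 9-approximation
(`DLe_estimate`, `estimate_le`). Take `g` to be `ε / 64` times this value and group the vertices
greedily into clusters of diameter `g`. At most one gap between clusters is caused by the long edge,
so there are `O(1 + 1/ε)` clusters (`Clusters.last_mul_le`). Replacing vertices by clusters changes
the optimum by at most `6 g` (`Clusters.DLe_of_forall`, `Clusters.exists_of_DLe`).

A value `μ` can be tested in time linear in the number of clusters. The pairs of intervals too far
apart on the path matter only through four maxima, which two pointers find (`Corners`). A shortcut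
is then good when its `score` is at most `μ`. For a fixed left end, the score is the shortcut weight
plus a falling or a rising function of the right end, with a single threshold. The graph-metric
property makes the weight 1-Lipschitz, so only columns next to the threshold matter
(`exists_score_le`). The thresholds are monotone over the rows (`threshold_mono`), so one staircase
walk visits all candidates.

Bisection from the interval between `0` and the first estimate down to width `g` takes about `log
(64 / ε)` tests and loses at most `7 g`, which is at most `ε` times the optimum.

The program is verified by weakest preconditions for loop-free code and by loop invariants with a
bound on the remaining iterations. -/

theorem WalkLength.append {V : Type} {E : V → V → ℝ → Prop} {u v z : V} {x y : ℝ}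
    (h : WalkLength E u v x) (h' : WalkLength E v z y) : WalkLength E u z (x + y) := by
  induction h with
  | nil u => simpa using h'
  | cons e _ ih => rw [add_assoc]; exact .cons e (ih h')

theorem WalkLength.mono {V : Type} {E E' : V → V → ℝ → Prop} (hE : ∀ u v x, E u v x → E' u v x)
    {u v : V} {x : ℝ} (h : WalkLength E u v x) : WalkLength E' u v x := by
  induction h with
  | nil u => exact .nil u
  | cons e _ ih => exact .cons (hE _ _ _ e) ih

theorem WalkLength.single {V : Type} {E : V → V → ℝ → Prop} {u v : V} {x : ℝ} (h : E u v x) :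
    WalkLength E u v x := by
  simpa using WalkLength.cons h (.nil v)

/-- A function satisfying the triangle inequality along edges bounds walk lengths from below. -/
theorem WalkLength.le_of_edge {V : Type} {E : V → V → ℝ → Prop} {F : V → V → ℝ}
    (hF : ∀ u, F u u ≤ 0) (hE : ∀ u v z x, E u v x → F u z ≤ x + F v z) {u v : V} {x : ℝ}
    (h : WalkLength E u v x) : F u v ≤ x := by
  induction h with
  | nil u => exact hF u
  | cons e _ ih => linarith [hE _ _ _ _ e |>.trans (add_le_add_right ih _)]

/-- A candidate that obeys the triangle inequality along edges lies below every walk length, and one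
walk attains it. No shortest walk has to be analysed. -/
theorem graphDist_eq {V : Type} {E : V → V → ℝ → Prop} {F : V → V → ℝ}
    (hF : ∀ u, F u u ≤ 0) (hE : ∀ u v z x, E u v x → F u z ≤ x + F v z) {u v : V}
    (h : WalkLength E u v (F u v)) : graphDist E u v = F u v :=
  le_antisymm (csInf_le ⟨F u v, fun _ hx => hx.le_of_edge hF hE⟩ h)
    (le_csInf ⟨_, h⟩ fun _ hx => hx.le_of_edge hF hE)

theorem walkLength_pathEdge_of_le {n : ℕ} {δ : Fin n → ℝ} {X : ℕ → ℝ}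
    (hX : ∀ k : Fin n, X (k + 1) = X k + δ k) (u : ℕ) (hu : u < n + 1) (d : ℕ)
    (hd : u + d < n + 1) :
    WalkLength (pathEdge δ) ⟨u, hu⟩ ⟨u + d, hd⟩ (X (u + d) - X u) ∧
      WalkLength (pathEdge δ) ⟨u + d, hd⟩ ⟨u, hu⟩ (X (u + d) - X u) := by
  induction d with
  | zero => simpa using WalkLength.nil _
  | succ d ih =>
    obtain ⟨h1, h2⟩ := ih (by omega)
    have hk : u + d < n := by omega
    have hx := hX ⟨u + d, hk⟩
    have e : X (u + (d + 1)) - X u = (X (u + d) - X u) + δ ⟨u + d, hk⟩ := by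
      rw [← add_assoc]; simp only at hx; linarith
    rw [e]
    refine ⟨h1.append (.single ⟨⟨u + d, hk⟩, rfl, .inl ⟨rfl, rfl⟩⟩), ?_⟩
    rw [add_comm (X (u + d) - X u)]
    exact .cons ⟨⟨u + d, hk⟩, rfl, .inr ⟨rfl, rfl⟩⟩ h2

theorem walkLength_pathEdge {n : ℕ} {δ : Fin n → ℝ} {X : ℕ → ℝ}
    (hX : ∀ k : Fin n, X (k + 1) = X k + δ k) (hmono : Monotone X) (u v : Fin (n + 1)) :
    WalkLength (pathEdge δ) u v |X u - X v| := by
  rcases le_total u v with h | h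
  · have h' : (u : ℕ) ≤ v := h
    obtain ⟨d, hd⟩ := Nat.exists_eq_add_of_le h'
    have := (walkLength_pathEdge_of_le hX u u.2 d (hd ▸ v.2)).1
    rw [abs_sub_comm, abs_of_nonneg (sub_nonneg.2 (hmono h'))]
    convert this using 2; simp [hd]
  · have h' : (v : ℕ) ≤ u := h
    obtain ⟨d, hd⟩ := Nat.exists_eq_add_of_le h'
    have := (walkLength_pathEdge_of_le hX v v.2 d (hd ▸ u.2)).2
    rw [abs_of_nonneg (sub_nonneg.2 (hmono h'))]
    convert this using 2; simp [hd]

theorem abs_sub_le_of_pathEdge {n : ℕ} {δ : Fin n → ℝ} {X : ℕ → ℝ}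
    (hX : ∀ k : Fin n, X (k + 1) = X k + δ k) (hmono : Monotone X) {u v : Fin (n + 1)} {x : ℝ}
    (h : pathEdge δ u v x) : |X u - X v| ≤ x := by
  obtain ⟨k, rfl, ⟨rfl, rfl⟩ | ⟨rfl, rfl⟩⟩ := h
  all_goals
    have h1 := hX k
    have h2 : X k ≤ X (k + 1) := hmono (Nat.le_succ _)
    simp only [Fin.val_castSucc, Fin.val_succ]
    rw [abs_le]; constructor <;> linarith

theorem graphDist_pathEdge {n : ℕ} {δ : Fin n → ℝ} {X : ℕ → ℝ}
    (hX : ∀ k : Fin n, X (k + 1) = X k + δ k) (hmono : Monotone X) (u v : Fin (n + 1)) :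
    graphDist (pathEdge δ) u v = |X u - X v| := by
  refine graphDist_eq (F := fun u v : Fin (n + 1) => |X u - X v|) (by simp) ?_
    (walkLength_pathEdge hX hmono u v)
  intro u v z x h
  exact (abs_sub_le (X u) (X v) (X z)).trans
    (add_le_add_left (abs_sub_le_of_pathEdge hX hmono h) _)

/-- A shortest walk uses the new edge at most once, in one of two directions. -/
theorem graphDist_addEdge_pathEdge {n : ℕ} {δ : Fin n → ℝ} {X : ℕ → ℝ}
    (hX : ∀ k : Fin n, X (k + 1) = X k + δ k) (hmono : Monotone X) {a : ℝ} (ha : 0 ≤ a)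
    (i j u v : Fin (n + 1)) :
    graphDist (addEdge (pathEdge δ) i j a) u v =
      min |X u - X v| (min (|X u - X i| + a + |X j - X v|) (|X u - X j| + a + |X i - X v|)) := by
  refine graphDist_eq (F := fun u v : Fin (n + 1) => min |X u - X v|
    (min (|X u - X i| + a + |X j - X v|) (|X u - X j| + a + |X i - X v|))) (by simp) ?_ ?_
  · intro u v z x h
    rw [← min_add_add_left, ← min_add_add_left]
    obtain h | ⟨rfl, ⟨rfl, rfl⟩ | ⟨rfl, rfl⟩⟩ := h
    · have h := abs_sub_le_of_pathEdge hX hmono h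
      have := abs_sub_le (X u) (X v) (X z)
      have := abs_sub_le (X u) (X v) (X i)
      have := abs_sub_le (X u) (X v) (X j)
      exact min_le_min (by linarith) (min_le_min (by linarith) (by linarith))
    · have := abs_nonneg (X v - X u)
      simp only [le_min_iff]
      -- A second use of the new edge in the same direction is matched with a single use, and a
      -- return over it with the direct route along the path.
      refine ⟨min_le_of_right_le (min_le_of_left_le ?_),
        min_le_of_right_le (min_le_of_left_le ?_), min_le_of_left_le ?_⟩
      all_goals simp
      all_goals linarith
    · have := abs_nonneg (X v - X u)
      simp only [le_min_iff]
      refine ⟨min_le_of_right_le (min_le_of_right_le ?_), min_le_of_left_le ?_,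
        min_le_of_right_le (min_le_of_right_le ?_)⟩
      all_goals simp
      all_goals linarith
  · have hw : ∀ u v, WalkLength (addEdge (pathEdge δ) i j a) u v |X u - X v| := fun u v =>
      (walkLength_pathEdge hX hmono u v).mono fun _ _ _ h => .inl h
    have h1 : WalkLength (addEdge (pathEdge δ) i j a) i j a :=
      .single (.inr ⟨rfl, .inl ⟨rfl, rfl⟩⟩)
    have h2 : WalkLength (addEdge (pathEdge δ) i j a) j i a :=
      .single (.inr ⟨rfl, .inr ⟨rfl, rfl⟩⟩)
    rcases min_choice |X u - X v|
      (min (|X u - X i| + a + |X j - X v|) (|X u - X j| + a + |X i - X v|)) with h | h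
    · rw [h]; exact hw u v
    · rw [h]
      rcases min_choice (|X u - X i| + a + |X j - X v|) (|X u - X j| + a + |X i - X v|) with h | h
      · rw [h]; exact ((hw u i).append h1).append (hw j v)
      · rw [h]; exact ((hw u j).append h2).append (hw i v)

namespace WDoap

/-! ## Instances in terms of positions on the line -/

/-- Edge weights, indexed by natural numbers. -/
noncomputable def edgeWt (I : WDoap) (k : ℕ) : ℝ := if h : k < I.n then I.δ ⟨k, h⟩ else 0

/-- Node weights, indexed by natural numbers. -/
noncomputable def nodeWt (I : WDoap) (k : ℕ) : ℝ := if h : k < I.n + 1 then I.w ⟨k, h⟩ else 0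

/-- Position of a vertex: its distance from the first one. -/
noncomputable def pos (I : WDoap) (k : ℕ) : ℝ := ∑ l ∈ Finset.range k, I.edgeWt l

/-- Length of the path. -/
noncomputable def len (I : WDoap) : ℝ := I.pos I.n

/-- Shortcut weights, indexed by natural numbers. -/
noncomputable def cost (I : WDoap) (u v : ℕ) : ℝ := RealRAM.answer I u v

/-- Right end of the interval of radius `nodeWt k` around `pos k`. -/
noncomputable def right (I : WDoap) (k : ℕ) : ℝ := I.pos k + I.nodeWt k

/-- Negated left end of the interval of radius `nodeWt k` around `pos k`. -/
noncomputable def left (I : WDoap) (k : ℕ) : ℝ := I.nodeWt k - I.pos k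

variable (I : WDoap)

theorem edgeWt_nonneg (k : ℕ) : 0 ≤ I.edgeWt k := by
  unfold edgeWt; split_ifs with h
  · exact (I.δ_pos _).le
  · exact le_rfl

theorem edgeWt_pos {k : ℕ} (h : k < I.n) : 0 < I.edgeWt k := by
  simp [edgeWt, h, I.δ_pos]

@[simp] theorem pos_zero : I.pos 0 = 0 := by simp [pos]

theorem pos_succ (k : ℕ) : I.pos (k + 1) = I.pos k + I.edgeWt k := by
  simp [pos, Finset.sum_range_succ]

theorem pos_mono : Monotone I.pos :=
  monotone_nat_of_le_succ fun k => by rw [pos_succ]; linarith [I.edgeWt_nonneg k]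

theorem pos_nonneg (k : ℕ) : 0 ≤ I.pos k := by
  simpa using I.pos_mono (Nat.zero_le k)

theorem pos_lt {u v : ℕ} (h : u < v) (hv : v ≤ I.n) : I.pos u < I.pos v :=
  calc I.pos u < I.pos (u + 1) := by rw [pos_succ]; linarith [I.edgeWt_pos (k := u) (by omega)]
    _ ≤ I.pos v := I.pos_mono h

theorem lt_of_pos_lt {u v : ℕ} (h : I.pos u < I.pos v) : u < v := I.pos_mono.reflect_lt h

theorem pos_le_len {k : ℕ} (h : k ≤ I.n) : I.pos k ≤ I.len := I.pos_mono h

theorem len_pos : 0 < I.len := by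
  simpa [len] using I.pos_lt (u := 0) (v := I.n) I.one_le_n le_rfl

theorem pos_step (k : Fin I.n) : I.pos (k + 1) = I.pos k + I.δ k := by
  simp [pos_succ, edgeWt]

theorem graphDist_eq_abs (u v : Fin (I.n + 1)) :
    graphDist (pathEdge I.δ) u v = |I.pos u - I.pos v| :=
  graphDist_pathEdge I.pos_step I.pos_mono u v

theorem nodeWt_nonneg (k : ℕ) : 0 ≤ I.nodeWt k := by
  unfold nodeWt; split_ifs with h
  · exact I.w_nonneg _
  · exact le_rfl

theorem nodeWt_fin (v : Fin (I.n + 1)) : I.nodeWt v = I.w v := by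
  rw [nodeWt, dif_pos v.2]

theorem nodeWt_le {k : ℕ} (h : k ≤ I.n) : I.nodeWt k ≤ I.pos k ∧ I.nodeWt k ≤ I.len - I.pos k := by
  have h1 := I.w_le ⟨k, by omega⟩
  have h2 := I.pos_le_len h
  rw [graphDist_eq_abs, graphDist_eq_abs, ← nodeWt_fin, le_min_iff] at h1
  simp only [Fin.val_zero, pos_zero, zero_sub, abs_neg, abs_of_nonneg (I.pos_nonneg k),
    Fin.val_last] at h1
  rw [abs_sub_comm, abs_of_nonneg (sub_nonneg.2 (I.pos_mono h))] at h1
  exact h1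

theorem cost_nonneg (u v : ℕ) : 0 ≤ I.cost u v := by
  unfold cost RealRAM.answer; split_ifs with h
  · exact I.c_nonneg _ _
  · exact le_rfl

theorem cost_comm (u v : ℕ) : I.cost u v = I.cost v u := by
  unfold cost RealRAM.answer
  by_cases h : u < I.n + 1 ∧ v < I.n + 1
  · rw [dif_pos h, dif_pos h.symm, I.c_symm]
  · rw [dif_neg h, dif_neg fun h' => h h'.symm]

theorem cost_fin (u v : Fin (I.n + 1)) : I.cost u v = I.c u v := by
  rw [cost, RealRAM.answer, dif_pos ⟨u.2, v.2⟩]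

theorem cost_le {u v z : ℕ} (hu : u ≤ I.n) (hv : v ≤ I.n) (hz : z ≤ I.n) (huv : u ≠ v)
    (huz : u ≠ z) : I.cost u v ≤ I.cost u z + |I.pos z - I.pos v| := by
  by_cases hvz : v = z
  · simp [hvz]
  have := I.graph_triangle ⟨u, by omega⟩ ⟨v, by omega⟩ ⟨z, by omega⟩ (by simpa using huv)
    (by simpa using huz) (by simpa using hvz)
  rw [graphDist_eq_abs, ← cost_fin, ← cost_fin] at this
  exact this

theorem cost_le' {u v z : ℕ} (hu : u ≤ I.n) (hv : v ≤ I.n) (hz : z ≤ I.n) (huv : u ≠ v)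
    (huz : u ≠ z) : I.cost v u ≤ I.cost z u + |I.pos z - I.pos v| := by
  rw [cost_comm, I.cost_comm z]; exact I.cost_le hu hv hz huv huz

/-- The end points are moved one at a time. The values of `c` on the diagonal are unconstrained, so
the order of the moves is chosen to keep the intermediate pair nondegenerate. -/
theorem cost_le_cost {i j i' j' : ℕ} (hi : i < j) (hj : j ≤ I.n) (hi' : i' < j') (hj' : j' ≤ I.n) :
    I.cost i' j' ≤ I.cost i j + |I.pos i - I.pos i'| + |I.pos j - I.pos j'| := by
  by_cases h : i' = j
  · have h1 := I.cost_le (u := i) (v := j') (z := j) (by omega) (by omega) (by omega) (by omega)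
      (by omega)
    have h2 := I.cost_le' (u := j') (v := i') (z := i) (by omega) (by omega) (by omega) (by omega)
      (by omega)
    linarith
  · have h1 := I.cost_le (u := i') (v := j') (z := j) (by omega) (by omega) (by omega) (by omega) h
    have h2 := I.cost_le' (u := j) (v := i') (z := i) (by omega) (by omega) (by omega)
      (Ne.symm h) (by omega)
    linarith

/-! ## The objective function -/

/-- By the exchange inequality on the line, matching `k` with `i` and `h` with `j` never costs more
than the crossed matching, so the backward direction of the shortcut drops out. -/
theorem augDist_eq {i j k h : Fin (I.n + 1)} (hij : i < j) (hkh : k < h) :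
    I.augDist i j k h = min (I.pos h - I.pos k)
      (|I.pos k - I.pos i| + I.cost i j + |I.pos h - I.pos j|) := by
  unfold augDist
  rw [graphDist_addEdge_pathEdge I.pos_step I.pos_mono (I.c_nonneg i j), ← cost_fin]
  have h1 : I.pos i ≤ I.pos j := I.pos_mono hij.le
  have h2 : I.pos k ≤ I.pos h := I.pos_mono hkh.le
  rw [abs_sub_comm (I.pos k) (I.pos h), abs_of_nonneg (sub_nonneg.2 h2), abs_sub_comm (I.pos h),
    min_eq_left (a := |I.pos k - I.pos i| + _ + _)]
  rcases abs_cases (I.pos k - I.pos i) with h3 | h3 <;>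
  rcases abs_cases (I.pos k - I.pos j) with h4 | h4 <;>
  rcases abs_cases (I.pos j - I.pos h) with h5 | h5 <;>
  rcases abs_cases (I.pos i - I.pos h) with h6 | h6 <;> linarith

/-- A bound on the objective function, for endpoints given as natural numbers. -/
def DLe (i j : ℕ) (μ : ℝ) : Prop :=
  ∀ k h, k < h → h ≤ I.n → I.right h + I.left k ≤ μ ∨
    max (I.right k - I.pos i) (I.left k + I.pos i) + I.cost i j +
      max (I.right h - I.pos j) (I.left h + I.pos j) ≤ μ

/-- This is the distance from `i` to the farthest point of the interval of `k`. As a maximum of two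
linear terms it splits the shortcut condition into four linear ones. -/
theorem max_right_left (k i : ℕ) :
    max (I.right k - I.pos i) (I.left k + I.pos i) = I.nodeWt k + |I.pos k - I.pos i| := by
  unfold right left
  rw [abs_eq_max_neg, ← max_add_add_left]
  congr 1 <;> ring

theorem D_le_iff {i j : Fin (I.n + 1)} (hij : i < j) {μ : ℝ} :
    I.D i j ≤ μ ↔ I.DLe i j μ := by
  unfold D DLe
  rw [Finset.sup'_le_iff]
  have key : ∀ k h : Fin (I.n + 1), k < h → (I.w k + I.augDist i j k h + I.w h ≤ μ ↔
      I.right h + I.left k ≤ μ ∨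
    max (I.right k - I.pos i) (I.left k + I.pos i) + I.cost i j +
      max (I.right h - I.pos j) (I.left h + I.pos j) ≤ μ) := by
    intro k h hkh
    rw [I.augDist_eq hij hkh, max_right_left, max_right_left, ← nodeWt_fin, ← nodeWt_fin,
      ← min_add_add_left, ← min_add_add_right, min_le_iff]
    unfold right left
    constructor <;> rintro (h | h)
    · left; linarith
    · right; linarith
    · left; linarith
    · right; linarith
  constructor
  · intro H k h hkh hn
    have := H (⟨k, by omega⟩, ⟨h, by omega⟩) (by simp [pairs, hkh])
    exact (key ⟨k, by omega⟩ ⟨h, by omega⟩ hkh).1 this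
  · rintro H ⟨k, h⟩ hp
    simp only [pairs, Finset.mem_filter, Finset.mem_univ, true_and] at hp
    exact (key k h hp).2 (H k h hp (by omega))

/-- The bound on the node weights keeps every interval inside the path. -/
theorem DLe_len (i j : ℕ) : I.DLe i j I.len := by
  intro k h hkh hn
  left
  have h1 := I.nodeWt_le (k := k) (by omega)
  have h2 := I.nodeWt_le (k := h) (by omega)
  unfold right left
  linarith [h1.1, h2.2]

variable {I} in
theorem DLe.dist_le {i j : ℕ} {μ : ℝ} (H : I.DLe i j μ) {k h : ℕ} (hkh : k < h) (hn : h ≤ I.n) :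
    I.nodeWt k + I.nodeWt h + (I.pos h - I.pos k) ≤ μ ∨
      I.nodeWt k + I.nodeWt h + |I.pos k - I.pos i| + I.cost i j + |I.pos h - I.pos j| ≤ μ := by
  have := H k h hkh hn
  rw [max_right_left, max_right_left] at this
  unfold right left at this
  rcases this with h | h
  · left; linarith
  · right; linarith

variable {I} in
theorem DLe.nonneg {i j : ℕ} {μ : ℝ} (H : I.DLe i j μ) : 0 ≤ μ := by
  have h1 := I.nodeWt_nonneg 0
  have h2 := I.nodeWt_nonneg I.n
  have h3 := I.len_pos
  have h4 := I.cost_nonneg i j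
  have h5 := abs_nonneg (I.pos 0 - I.pos i)
  have h6 := abs_nonneg (I.pos I.n - I.pos j)
  have := H.dist_le (k := 0) (h := I.n) I.one_le_n le_rfl
  rw [pos_zero] at *
  unfold len at h3
  rcases this with h | h <;> linarith

variable {I} in
-- Consider `v` together with each end of the path. If one of these pairs is close along the path,
-- the claim follows because the weight is at most the distance to that end. If both use the
-- shortcut, their routes together cover the whole path, whose length is at least twice the weight
-- of `v`.
theorem DLe.two_mul_nodeWt_le {i j : ℕ} {μ : ℝ} (H : I.DLe i j μ) {v : ℕ} (hv : v ≤ I.n) : 2 * I.nodeWt v ≤ μ := by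
  have h0 := H.nonneg
  have hw := I.nodeWt_le hv
  rcases Nat.eq_zero_or_pos v with rfl | hv0
  · have := hw.1; rw [pos_zero] at this; linarith
  rcases hv.eq_or_lt with rfl | hvn
  · have := hw.2; unfold len at this; linarith
  have h1 := H.dist_le hv0 hv
  have h2 := H.dist_le hvn le_rfl
  have h3 := I.nodeWt_nonneg 0
  have h4 := I.nodeWt_nonneg I.n
  have h5 := I.cost_nonneg i j
  rw [pos_zero] at h1
  unfold len at hw
  have h6 := abs_nonneg (I.pos v - I.pos j)
  have h7 := le_abs_self (I.pos v - I.pos i)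
  have h8 := neg_abs_le (I.pos v - I.pos j)
  have h9 := le_abs_self (I.pos I.n - I.pos j)
  have h10 := neg_abs_le (0 - I.pos i)
  rcases h1 with h1 | h1
  · linarith [hw.1]
  rcases h2 with h2 | h2
  · linarith [hw.2]
  linarith [hw.1, hw.2]

variable {I} in
/-- The bound extends to all ordered pairs of vertices. -/
theorem DLe.all {i j : ℕ} {μ : ℝ} (H : I.DLe i j μ) {k h : ℕ} (hk : k ≤ I.n) (hh : h ≤ I.n) : I.right h + I.left k ≤ μ ∨
    max (I.right k - I.pos i) (I.left k + I.pos i) + I.cost i j +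
      max (I.right h - I.pos j) (I.left h + I.pos j) ≤ μ := by
  rcases lt_or_ge k h with hkh | hkh
  · exact H k h hkh hh
  · left
    -- In the reversed order the difference of positions is not positive, and the two weights are
    -- each at most `μ / 2`.
    have h1 := H.two_mul_nodeWt_le hk
    have h2 := H.two_mul_nodeWt_le hh
    have := I.pos_mono hkh
    unfold right left
    linarith

/-! ### Lower bounds on the optimum -/

section LowerBounds

variable {I} {i j : ℕ} {μ : ℝ} (hij : i < j) (hj : j ≤ I.n) (H : I.DLe i j μ)
include hij hj H

/-- The pair of the first vertex and `i` gains nothing: even the route over the shortcut passes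
through `i` first. -/
theorem DLe.pos_left_le : I.pos i ≤ μ := by
  rcases Nat.eq_zero_or_pos i with rfl | hi
  · simpa using H.nonneg
  have h1 := H.dist_le hi (by omega)
  have h3 := I.nodeWt_nonneg 0
  have h4 := I.nodeWt_nonneg i
  have h5 := I.cost_nonneg i j
  have h6 := neg_abs_le (I.pos 0 - I.pos i)
  have h7 := abs_nonneg (I.pos i - I.pos j)
  rw [pos_zero] at *
  rcases h1 with h | h <;> linarith

theorem DLe.pos_right_ge : I.len - I.pos j ≤ μ := by
  unfold len
  rcases hj.eq_or_lt with rfl | hi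
  · simpa using H.nonneg
  have h1 := H.dist_le hi le_rfl
  have h3 := I.nodeWt_nonneg j
  have h4 := I.nodeWt_nonneg I.n
  have h5 := I.cost_nonneg i j
  have h6 := abs_nonneg (I.pos j - I.pos i)
  have h7 := le_abs_self (I.pos I.n - I.pos j)
  rcases h1 with h | h <;> linarith

/-- Apart from one edge, the whole path has length at most `4 μ`. -/
theorem DLe.exists_edge : ∃ k < I.n, I.len - I.edgeWt k ≤ 4 * μ := by
  have h1 := H.pos_left_le hij hj
  have h2 := H.pos_right_ge hij hj
  have h0 := H.nonneg
  by_cases hc : I.pos j - I.pos i ≤ μ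
  · exact ⟨0, I.one_le_n, by linarith [I.edgeWt_nonneg 0]⟩
  classical
  have hex : ∃ k, ¬ I.pos k - I.pos i ≤ μ := ⟨j, hc⟩
  -- Let `k` be the first vertex farther than `μ` from `i`. The pair `(i, k)` must use the shortcut,
  -- so `k` is within `μ` of `j`. Outside the edge before `k`, the path consists of four pieces of
  -- length at most `μ`.
  set k := Nat.find hex with hk
  have hk1 : ¬ I.pos k - I.pos i ≤ μ := Nat.find_spec hex
  have hkj : k ≤ j := Nat.find_min' hex hc
  have hik : i < k := I.lt_of_pos_lt (by linarith)
  obtain ⟨l, hl⟩ : ∃ l, k = l + 1 := ⟨k - 1, by omega⟩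
  have hl1 : I.pos l - I.pos i ≤ μ := by
    by_contra hcon
    have := Nat.find_min' hex hcon
    omega
  refine ⟨l, by omega, ?_⟩
  have h3 := H.dist_le hik (by omega)
  have h4 := I.nodeWt_nonneg i
  have h5 := I.nodeWt_nonneg k
  have h6 := I.cost_nonneg i j
  have h7 := neg_abs_le (I.pos k - I.pos j)
  have h8 := abs_nonneg (I.pos i - I.pos i)
  have h9 := I.pos_succ l
  rw [← hl] at h9
  rcases h3 with h | h <;> linarith

/-- If the two ends of the edge `m` are joined through `(i, j)`, the graph-metric property bounds
the weight of the direct shortcut by the length of that route. -/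
theorem DLe.min_le {m : ℕ} (hm : m < I.n) : min (I.edgeWt m) (I.cost m (m + 1)) ≤ μ := by
  have h1 := H.dist_le (Nat.lt_succ_self m) hm
  have h2 := I.nodeWt_nonneg m
  have h3 := I.nodeWt_nonneg (m + 1)
  have h4 := I.pos_succ m
  rw [min_le_iff]
  rcases h1 with h | h
  · left; simp only [Nat.succ_eq_add_one] at h; linarith
  · right
    have := I.cost_le_cost hij hj (Nat.lt_succ_self m) hm
    simp only [Nat.succ_eq_add_one] at *
    rw [abs_sub_comm (I.pos i), abs_sub_comm (I.pos j)] at this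
    linarith

/-- A shortcut saves at most the distance between its end points on the way from one end of the path
to the other. -/
theorem DLe.len_sub_le {g : ℝ} (hg : I.pos j - I.pos i ≤ g) : I.len - g ≤ μ := by
  have h1 := H.pos_left_le hij hj
  have h := H.dist_le (k := 0) (h := I.n) I.one_le_n le_rfl
  have h2 := I.nodeWt_nonneg 0
  have h3 := I.nodeWt_nonneg I.n
  have h4 := I.cost_nonneg i j
  have h5 := neg_abs_le (I.pos 0 - I.pos i)
  have h6 := le_abs_self (I.pos I.n - I.pos j)
  have h7 := I.pos_mono hij.le
  rw [pos_zero] at *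
  unfold len
  rcases h with h | h <;> linarith

end LowerBounds

/-! ## A constant-factor approximation -/

/-- The length of the path without its `m`-th edge. -/
noncomputable def rest (m : ℕ) : ℝ := I.len - I.edgeWt m

/-- An estimate of the optimum, up to a constant factor, if `m` is a longest edge. -/
noncomputable def estimate (m : ℕ) : ℝ :=
  2 * I.rest m + min (I.edgeWt m) (I.cost m (m + 1))

theorem pos_add_rest {m : ℕ} : I.rest m = I.pos m + (I.len - I.pos (m + 1)) := by
  rw [rest, pos_succ]; ring

theorem rest_nonneg {m : ℕ} (hm : m < I.n) : 0 ≤ I.rest m := by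
  rw [pos_add_rest]
  linarith [I.pos_nonneg m, I.pos_le_len (k := m + 1) hm]

theorem rest_le_estimate {m : ℕ} (hm : m < I.n) : I.rest m ≤ I.estimate m := by
  have := le_min (I.edgeWt_nonneg m) (I.cost_nonneg m (m + 1))
  rw [estimate]; linarith [I.rest_nonneg hm]

theorem estimate_nonneg {m : ℕ} (hm : m < I.n) : 0 ≤ I.estimate m :=
  (I.rest_nonneg hm).trans (I.rest_le_estimate hm)

/-- Edge weights are positive. This settles the degenerate case of cluster size `0`. -/
theorem eq_of_rest_eq_zero {m : ℕ} (hm : m < I.n) (h : I.rest m = 0) : I.n = 1 := by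
  rw [pos_add_rest] at h
  have h1 := I.pos_nonneg m
  have h2 := I.pos_le_len (k := m + 1) hm
  have h3 : m = 0 := by
    by_contra hne
    have := I.pos_lt (u := 0) (v := m) (by omega) (by omega)
    rw [pos_zero] at this; linarith
  subst h3
  by_contra hne
  have hn := I.one_le_n
  have := I.pos_lt (u := 0 + 1) (v := I.n) (by omega) le_rfl
  unfold len at h2 h; linarith

/-- Across the edge `m`, the node weights are absorbed by the distances to the ends of the path. For
two vertices on the same side, the weight and the distance can each contribute the length of that
side, hence the factor `2` in `estimate`. -/
theorem DLe_estimate {m : ℕ} (hm : m < I.n) : I.DLe m (m + 1) (I.estimate m) := by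
  intro k h hkh hn
  have h0 := I.rest_nonneg hm
  have hmin := le_min (I.edgeWt_nonneg m) (I.cost_nonneg m (m + 1))
  have hk' := I.nodeWt_le (k := k) (by omega)
  have hh' := I.nodeWt_le hn
  have hl := I.pos_le_len (k := m + 1) hm
  have hp := I.pos_nonneg m
  have hkh' := I.pos_mono hkh.le
  rw [max_right_left, max_right_left, estimate]
  rw [pos_add_rest] at *
  unfold right left
  rcases lt_or_ge m h with h1 | h1
  · rcases le_or_gt k m with h2 | h2
    · have h3 := I.pos_mono h2
      have h4 : I.pos (m + 1) ≤ I.pos h := I.pos_mono h1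
      rw [abs_of_nonpos (by linarith), abs_of_nonneg (by linarith)]
      rcases min_choice (I.edgeWt m) (I.cost m (m + 1)) with h5 | h5 <;> rw [h5]
      · left; linarith [I.pos_succ m]
      · right; linarith
    · left
      have : I.pos (m + 1) ≤ I.pos k := I.pos_mono h2
      linarith
  · left
    have := I.pos_mono h1
    linarith

/-- A longest edge leaves the smallest rest, so `rest m` is at most `4 μ`; the minimum is at most
`μ`, and `2 * 4 + 1 = 9`. -/
theorem estimate_le {m : ℕ} (hm : m < I.n) (hmax : ∀ k < I.n, I.edgeWt k ≤ I.edgeWt m) {i j : ℕ}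
    {μ : ℝ} (hij : i < j) (hj : j ≤ I.n) (H : I.DLe i j μ) : I.estimate m ≤ 9 * μ := by
  obtain ⟨k, hk, h⟩ := H.exists_edge hij hj
  have := H.min_le hij hj hm
  have := hmax k hk
  rw [estimate, rest]; linarith

end WDoap

namespace RealRAM

/-! ## Reasoning about programs -/

/-- From `s`, the program `p` halts within `T` steps in a state satisfying `Q`. -/
def Exec (I : WDoap) (S : ℕ) (p : Prog) (s : State) (T : ℕ) (Q : State → Prop) : Prop :=
  ∃ s' t, Run I S p s s' t ∧ t ≤ T ∧ Q s'

/-- An upper bound on the running time of a loop-free program. -/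
def Prog.bound : Prog → ℕ
  | .nop => 1
  | .setNat _ e => e.steps + 1
  | .setReal _ e => e.steps + 1
  | .storeNat _ idx e => idx.steps + e.steps + 1
  | .storeReal _ idx e => idx.steps + e.steps + 1
  | .seq p q => p.bound + q.bound
  | .cond b p q => b.steps + (p.bound + q.bound) + 1
  | .loop _ _ => 0

/-- Weakest preconditions of loop-free programs. -/
def wp (I : WDoap) (S : ℕ) : Prog → (State → Prop) → State → Prop
  | .nop, Q, s => Q s
  | .setNat x e, Q, s => e.Safe S s ∧ Q (s.setNat x (e.eval s))
  | .setReal x e, Q, s => e.Safe I S s ∧ Q (s.setReal x (e.eval I s))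
  | .storeNat arr idx e, Q, s => (idx.Safe S s ∧ idx.eval s < S ∧ e.Safe S s) ∧
      Q (s.storeNat arr (idx.eval s) (e.eval s))
  | .storeReal arr idx e, Q, s => (idx.Safe S s ∧ idx.eval s < S ∧ e.Safe I S s) ∧
      Q (s.storeReal arr (idx.eval s) (e.eval I s))
  | .seq p q, Q, s => wp I S p (wp I S q Q) s
  | .cond b p q, Q, s => b.Safe I S s ∧ (b.Holds I s → wp I S p Q s) ∧
      (¬ b.Holds I s → wp I S q Q s)
  | .loop _ _, _, _ => False

variable {I : WDoap} {S : ℕ}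

theorem Exec.of_wp {p : Prog} {Q : State → Prop} {s : State} (h : wp I S p Q s) :
    Exec I S p s p.bound Q := by
  induction p generalizing s Q with
  | nop => exact ⟨_, _, .nop s, le_rfl, h⟩
  | setNat x e => exact ⟨_, _, .setNat s x e h.1, le_rfl, h.2⟩
  | setReal x e => exact ⟨_, _, .setReal s x e h.1, le_rfl, h.2⟩
  | storeNat arr idx e => exact ⟨_, _, .storeNat s arr idx e h.1.1 h.1.2.1 h.1.2.2, le_rfl, h.2⟩
  | storeReal arr idx e => exact ⟨_, _, .storeReal s arr idx e h.1.1 h.1.2.1 h.1.2.2, le_rfl, h.2⟩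
  | seq p q ihp ihq =>
    obtain ⟨s', t, h1, h2, h3⟩ := ihp h
    obtain ⟨s'', t', h4, h5, h6⟩ := ihq h3
    exact ⟨_, _, .seq h1 h4, add_le_add h2 h5, h6⟩
  | cond b p q ihp ihq =>
    obtain ⟨hs, hp, hq⟩ := h
    by_cases hb : b.Holds I s
    · obtain ⟨s', t, h1, h2, h3⟩ := ihp (hp hb)
      exact ⟨_, _, .condTrue q hs hb h1, by simp only [Prog.bound]; omega, h3⟩
    · obtain ⟨s', t, h1, h2, h3⟩ := ihq (hq hb)
      exact ⟨_, _, .condFalse p hs hb h1, by simp only [Prog.bound]; omega, h3⟩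
  | loop b p => exact h.elim

theorem Exec.mono {p : Prog} {s : State} {T T' : ℕ} {Q Q' : State → Prop}
    (h : Exec I S p s T Q) (hT : T ≤ T') (hQ : ∀ s, Q s → Q' s) : Exec I S p s T' Q' :=
  let ⟨s', t, h1, h2, h3⟩ := h
  ⟨s', t, h1, h2.trans hT, hQ s' h3⟩

theorem Exec.seq {p q : Prog} {s : State} {T T' : ℕ} {Q R : State → Prop}
    (h : Exec I S p s T R) (h' : ∀ s, R s → Exec I S q s T' Q) :
    Exec I S (.seq p q) s (T + T') Q := by
  obtain ⟨s', t, h1, h2, h3⟩ := h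
  obtain ⟨s'', t', h4, h5, h6⟩ := h' s' h3
  exact ⟨_, _, .seq h1 h4, add_le_add h2 h5, h6⟩

/-- A loop with an invariant that contains a bound on the number of remaining iterations. -/
theorem Exec.loop {b : Test} {p : Prog} {C : ℕ} {Q : State → Prop} (Inv : ℕ → State → Prop)
    (hsafe : ∀ k s, Inv k s → b.Safe I S s)
    (hstep : ∀ k s, Inv k s → b.Holds I s → Exec I S p s C fun s' => ∃ k' < k, Inv k' s')
    (hpost : ∀ k s, Inv k s → ¬ b.Holds I s → Q s) {k : ℕ} {s : State} (hs : Inv k s) :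
    Exec I S (.loop b p) s ((C + b.steps + 1) * (k + 1)) Q := by
  induction k using Nat.strong_induction_on generalizing s with
  | _ k ih =>
    by_cases hb : b.Holds I s
    · obtain ⟨s', t, h1, h2, k', hk, h3⟩ := hstep k s hs hb
      obtain ⟨s'', t', h4, h5, h6⟩ := ih k' hk h3
      refine ⟨_, _, .loopTrue (hsafe k s hs) hb h1 h4, ?_, h6⟩
      calc b.steps + t + t' + 1 ≤ (C + b.steps + 1) * (k' + 1) + (C + b.steps + 1) := by omega
        _ = (C + b.steps + 1) * (k' + 1 + 1) := by ring
        _ ≤ _ := Nat.mul_le_mul_left _ (by omega)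
    · refine ⟨_, _, .loopFalse p (hsafe k s hs) hb, ?_, hpost k s hs hb⟩
      calc b.steps + 1 ≤ (C + b.steps + 1) * 1 := by omega
        _ ≤ _ := Nat.mul_le_mul_left _ (by omega)

/-- The cost of one iteration of a loop with a loop-free body. -/
def Prog.iter : Prog → ℕ
  | .loop b p => p.bound + b.steps + 1
  | _ => 0

theorem Exec.flatLoop {b : Test} {p : Prog} {Q : State → Prop} (Inv : ℕ → State → Prop)
    (hsafe : ∀ k s, Inv k s → b.Safe I S s)
    (hstep : ∀ k s, Inv k s → b.Holds I s → wp I S p (fun s' => ∃ k' < k, Inv k' s') s)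
    (hpost : ∀ k s, Inv k s → ¬ b.Holds I s → Q s) {k : ℕ} {s : State} (hs : Inv k s) :
    Exec I S (.loop b p) s ((Prog.loop b p).iter * (k + 1)) Q :=
  Exec.loop Inv hsafe (fun k s h hb => Exec.of_wp (hstep k s h hb)) hpost hs

section StateLemmas

variable (s : State) (x y a arr arr' idx k : ℕ) (r : ℝ)

theorem natReg_setNat : (s.setNat x a).natReg y = if y = x then a else s.natReg y := by
  simp [State.setNat, Function.update_apply]
theorem realReg_setNat : (s.setNat x a).realReg = s.realReg := rfl
theorem natArr_setNat : (s.setNat x a).natArr = s.natArr := rfl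
theorem realArr_setNat : (s.setNat x a).realArr = s.realArr := rfl
theorem natReg_setReal : (s.setReal x r).natReg = s.natReg := rfl
theorem realReg_setReal : (s.setReal x r).realReg y = if y = x then r else s.realReg y := by
  simp [State.setReal, Function.update_apply]
theorem natArr_setReal : (s.setReal x r).natArr = s.natArr := rfl
theorem realArr_setReal : (s.setReal x r).realArr = s.realArr := rfl
theorem natReg_storeNat : (s.storeNat arr idx a).natReg = s.natReg := rfl
theorem realReg_storeNat : (s.storeNat arr idx a).realReg = s.realReg := rfl
theorem natArr_storeNat : (s.storeNat arr idx a).natArr arr' =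
    if arr' = arr then Function.update (s.natArr arr) idx a else s.natArr arr' := by
  simp [State.storeNat, Function.update_apply]
theorem realArr_storeNat : (s.storeNat arr idx a).realArr = s.realArr := rfl
theorem natReg_storeReal : (s.storeReal arr idx r).natReg = s.natReg := rfl
theorem realReg_storeReal : (s.storeReal arr idx r).realReg = s.realReg := rfl
theorem natArr_storeReal : (s.storeReal arr idx r).natArr = s.natArr := rfl
theorem realArr_storeReal : (s.storeReal arr idx r).realArr arr' =
    if arr' = arr then Function.update (s.realArr arr) idx r else s.realArr arr' := by
  simp [State.storeReal, Function.update_apply]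

end StateLemmas

/-- Replace a real register by the maximum of it and the value of an expression. -/
def maxReal (x : ℕ) (e : RExpr) : Prog := .cond (.realLe (.reg x) e) (.setReal x e) .nop

/-- With the maximum as a single assignment, symbolic execution does not branch here. -/
theorem wp_maxReal {x : ℕ} {e : RExpr} {Q : State → Prop} {s : State} :
    wp I S (maxReal x e) Q s ↔ e.Safe I S s ∧ Q (s.setReal x (max (s.realReg x) (e.eval I s))) := by
  have h : s.setReal x (s.realReg x) = s := by simp [State.setReal]
  simp only [maxReal, wp, Test.Safe, RExpr.Safe, Test.Holds, RExpr.eval, true_and]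
  rcases le_or_gt (s.realReg x) (e.eval I s) with h1 | h1
  · simp only [h1, max_eq_right, not_true, false_implies, and_true, true_implies]
    tauto
  · simp only [h1.le, not_le.2 h1, max_eq_left, h, not_false_iff, false_implies, true_implies,
      true_and]

end RealRAM

namespace WDoap

/-! ## Clustering -/

/-- The vertices before `v` are grouped into clusters `0, …, a` of diameter at most `g`; `ix b` is
the first vertex of the cluster `b`, and the intervals `[-U b, P b]` approximate the intervals of
the vertices in `b`. -/
structure Clusters (I : WDoap) (g : ℝ) (v a : ℕ) (ix : ℕ → ℕ) (P U : ℕ → ℝ) : Prop where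
  ix_lt : ∀ b ≤ a, ix b < v
  gap : ∀ b < a, I.pos (ix b) + g < I.pos (ix (b + 1))
  P_le : ∀ b < a, P b ≤ P (b + 1)
  cover : ∀ u < v, ∃ b ≤ a, I.pos (ix b) ≤ I.pos u ∧ I.pos u ≤ I.pos (ix b) + g ∧
    I.right u ≤ P b ∧ I.left u ≤ U b
  P_eq : ∀ b ≤ a, ∃ k < v, P b = I.right k ∧ I.pos k ≤ I.pos (ix b) + g
  U_eq : ∀ b ≤ a, ∃ k < v, U b = I.left k ∧ I.pos (ix b) ≤ I.pos k

variable {I : WDoap} {g : ℝ} {a : ℕ} {ix : ℕ → ℕ} {P U : ℕ → ℝ}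

namespace Clusters

theorem gap_lt {v : ℕ} (H : Clusters I g v a ix P U) (hg : 0 ≤ g) {b b' : ℕ} (h : b < b')
    (h' : b' ≤ a) : I.pos (ix b) + g < I.pos (ix b') := by
  induction b' with
  | zero => omega
  | succ c ih =>
    have h1 := H.gap c h'
    rcases Nat.lt_succ_iff_lt_or_eq.1 h with h2 | rfl
    · linarith [ih h2 (by omega)]
    · exact h1

theorem ix_lt_ix {v : ℕ} (H : Clusters I g v a ix P U) (hg : 0 ≤ g) {b b' : ℕ} (h : b < b')
    (h' : b' ≤ a) : ix b < ix b' :=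
  I.lt_of_pos_lt (by linarith [H.gap_lt hg h h'])

theorem ix_mono {v : ℕ} (H : Clusters I g v a ix P U) (hg : 0 ≤ g) {b b' : ℕ} (h : b ≤ b')
    (h' : b' ≤ a) : ix b ≤ ix b' := by
  rcases h.eq_or_lt with rfl | h
  · rfl
  · exact (H.ix_lt_ix hg h h').le

/-- Clusters have distinct first vertices. This keeps the cluster indices within the arrays. -/
theorem last_lt {v : ℕ} (H : Clusters I g v a ix P U) (hg : 0 ≤ g) : a < v := by
  have : ∀ b ≤ a, b ≤ ix b := by
    intro b
    induction b with
    | zero => simp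
    | succ b ih => intro h; have := ih (by omega); have := H.ix_lt_ix hg (Nat.lt_add_one b) h; omega
  exact (this a le_rfl).trans_lt (H.ix_lt a le_rfl)

/-- The number of clusters is bounded in terms of the length of the path without one edge. -/
theorem last_mul_le (H : Clusters I g (I.n + 1) a ix P U) (hg : 0 ≤ g) (m : ℕ) (hm : m < I.n) :
    a * g ≤ I.rest m + g := by
  -- Consecutive first vertices are more than `g` apart. Once the edge `m` has been crossed, its
  -- length is deducted, at the price of the one gap that contains it.
  have key : ∀ b ≤ a, (ix b ≤ m → b * g ≤ I.pos (ix b)) ∧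
      (m < ix b → b * g ≤ I.pos (ix b) - I.edgeWt m + g) := by
    intro b
    induction b with
    | zero =>
      intro _
      refine ⟨fun _ => by simpa using I.pos_nonneg _, fun h => ?_⟩
      have h1 : I.pos (m + 1) ≤ I.pos (ix 0) := I.pos_mono h
      have h2 := I.pos_nonneg m
      rw [pos_succ] at h1
      push_cast; linarith
    | succ b ih =>
      intro hb
      obtain ⟨h1, h2⟩ := ih (by omega)
      have h3 := H.gap b hb
      have h4 := H.ix_lt_ix hg (Nat.lt_succ_self b) hb
      push_cast
      refine ⟨fun h => ?_, fun h => ?_⟩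
      · linarith [h1 (by simp only [Nat.succ_eq_add_one] at h4; omega)]
      · rcases le_or_gt (ix b) m with h5 | h5
        · have h6 := h1 h5
          have h7 : I.pos (m + 1) ≤ I.pos (ix (b + 1)) := I.pos_mono h
          have h8 := I.pos_mono h5
          rw [pos_succ] at h7
          linarith
        · linarith [h2 h5]
  obtain ⟨h1, h2⟩ := key a le_rfl
  have h3 := I.pos_le_len (k := ix a) (by have := H.ix_lt a le_rfl; omega)
  rcases le_or_gt (ix a) m with h | h
  · have := I.pos_mono h
    rw [pos_add_rest]
    linarith [h1 h, I.pos_le_len (k := m + 1) hm]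
  · rw [rest]; linarith [h2 h]

theorem P_mono {v : ℕ} (H : Clusters I g v a ix P U) {b b' : ℕ} (h : b ≤ b') (h' : b' ≤ a) :
    P b ≤ P b' := by
  induction h with
  | refl => rfl
  | step _ ih => exact (ih (by omega)).trans (H.P_le _ h')

/-- Every approximate interval is contained in the `g`-neighbourhood of a true one. -/
theorem exists_interval {v : ℕ} (H : Clusters I g v a ix P U) (hg : 0 ≤ g) {b : ℕ} (hb : b ≤ a) :
    ∃ k < v, P b - g ≤ I.right k ∧ U b - g ≤ I.left k := by
  obtain ⟨k, hk, h1, h2⟩ := H.P_eq b hb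
  obtain ⟨l, hl, h3, h4⟩ := H.U_eq b hb
  -- The two witnesses satisfy `pos k ≤ pos l + g`, so the one with the larger radius nearly reaches
  -- both ends.
  rcases le_total (I.nodeWt k) (I.nodeWt l) with h | h
  · refine ⟨l, hl, ?_, by linarith⟩
    rw [h1]; unfold right; linarith
  · refine ⟨k, hk, by linarith, ?_⟩
    rw [h3]; unfold left; linarith

end Clusters

theorem antitone_of_step {U : ℕ → ℝ} {a : ℕ} (hU : ∀ b < a, U (b + 1) ≤ U b) {b b' : ℕ}
    (h : b ≤ b') (h' : b' ≤ a) : U b' ≤ U b := by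
  induction h with
  | refl => rfl
  | step _ ih => exact (hU _ h').trans (ih (by omega))

/-! ## The feasibility test -/

/-- The pairs of intervals that are too far apart in the path determine four numbers. Here only
the first `k` intervals are compared with all the others. -/
structure Corners (a k : ℕ) (P U : ℕ → ℝ) (μ pp pm mp mm : ℝ) : Prop where
  le : ∀ k' h, k' < k → h ≤ a → μ < P h + U k' →
    P k' + P h ≤ pp ∧ P k' + U h ≤ pm ∧ U k' + P h ≤ mp ∧ U k' + U h ≤ mm
  pp_le : ∃ k h, k ≤ a ∧ h ≤ a ∧ μ < P h + U k ∧ pp ≤ P k + P h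
  pm_le : ∃ k h, k ≤ a ∧ h ≤ a ∧ μ < P h + U k ∧ pm ≤ P k + U h
  mp_le : ∃ k h, k ≤ a ∧ h ≤ a ∧ μ < P h + U k ∧ mp ≤ U k + P h
  mm_le : ∃ k h, k ≤ a ∧ h ≤ a ∧ μ < P h + U k ∧ mm ≤ U k + U h

/-- The extreme pair `(0, a)` is too far apart and seeds all four maxima, so no value for minus
infinity is needed. -/
theorem Corners.init (a : ℕ) (P U : ℕ → ℝ) {μ : ℝ} (h : μ < P a + U 0) :
    Corners a 0 P U μ (P 0 + P a) (P 0 + U a) (U 0 + P a) (U 0 + U a) where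
  le := by intro k' h hk; omega
  pp_le := ⟨0, a, by simp, le_rfl, h, le_rfl⟩
  pm_le := ⟨0, a, by simp, le_rfl, h, le_rfl⟩
  mp_le := ⟨0, a, by simp, le_rfl, h, le_rfl⟩
  mm_le := ⟨0, a, by simp, le_rfl, h, le_rfl⟩

/-- The partners of `k` that are too far away have indices from `h` to `a`. Among them `P` is
largest at `a` and `U` is largest at `h`. -/
theorem Corners.step {a k h : ℕ} {P U : ℕ → ℝ} {μ pp pm mp mm : ℝ}
    (H : Corners a k P U μ pp pm mp mm) (hP : ∀ h ≤ a, P h ≤ P a)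
    (hU : ∀ b b', b ≤ b' → b' ≤ a → U b' ≤ U b) (hk : k ≤ a) (hh : h ≤ a)
    (hlt : ∀ h' < h, P h' + U k ≤ μ) (hbad : μ < P h + U k) :
    Corners a (k + 1) P U μ (max pp (P k + P a)) (max pm (P k + U h)) (max mp (U k + P a))
      (max mm (U k + U h)) where
  le := by
    intro k' h' hk' hh' hb
    rcases Nat.lt_succ_iff_lt_or_eq.1 hk' with h1 | rfl
    · obtain ⟨h2, h3, h4, h5⟩ := H.le k' h' h1 hh' hb
      exact ⟨h2.trans (le_max_left _ _), h3.trans (le_max_left _ _), h4.trans (le_max_left _ _),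
        h5.trans (le_max_left _ _)⟩
    · have h1 : h ≤ h' := by
        by_contra hcon
        linarith [hlt h' (by omega)]
      have h2 := hU h h' h1 hh'
      have h3 := hP h' hh'
      refine ⟨le_max_of_le_right ?_, le_max_of_le_right ?_, le_max_of_le_right ?_,
        le_max_of_le_right ?_⟩ <;> linarith
  pp_le := by
    rcases max_choice pp (P k + P a) with h1 | h1 <;> rw [h1]
    · exact H.pp_le
    · exact ⟨k, a, hk, le_rfl, by linarith [hP h hh], le_rfl⟩
  pm_le := by
    rcases max_choice pm (P k + U h) with h1 | h1 <;> rw [h1]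
    · exact H.pm_le
    · exact ⟨k, h, hk, hh, hbad, le_rfl⟩
  mp_le := by
    rcases max_choice mp (U k + P a) with h1 | h1 <;> rw [h1]
    · exact H.mp_le
    · exact ⟨k, a, hk, le_rfl, by linarith [hP h hh], le_rfl⟩
  mm_le := by
    rcases max_choice mm (U k + U h) with h1 | h1 <;> rw [h1]
    · exact H.mm_le
    · exact ⟨k, h, hk, hh, hbad, le_rfl⟩

theorem Corners.extend {a k : ℕ} {P U : ℕ → ℝ} {μ pp pm mp mm : ℝ}
    (H : Corners a k P U μ pp pm mp mm)
    (h : ∀ k' h, k ≤ k' → k' ≤ a → h ≤ a → P h + U k' ≤ μ) : Corners a (a + 1) P U μ pp pm mp mm where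
  le := by
    intro k' h' hk hh hb
    refine H.le k' h' ?_ hh hb
    by_contra hcon
    linarith [h k' h' (by omega) (by omega) hh]
  pp_le := H.pp_le
  pm_le := H.pm_le
  mp_le := H.mp_le
  mm_le := H.mm_le

/-- The smallest bound that a shortcut of weight `c` between the positions `x` and `y` achieves for
all pairs of intervals that are too far apart. -/
noncomputable def score (pp pm mp mm c x y : ℝ) : ℝ :=
  c + max (max (pp - x) (mp + x) - y) (max (pm - x) (mm + x) + y)

theorem score_le_iff {pp pm mp mm c x y μ : ℝ} : score pp pm mp mm c x y ≤ μ ↔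
    c + pp - x - y ≤ μ ∧ c + mp + x - y ≤ μ ∧ c + pm - x + y ≤ μ ∧ c + mm + x + y ≤ μ := by
  have h : ∀ A B : ℝ, c + max A B ≤ μ ↔ c + A ≤ μ ∧ c + B ≤ μ := by
    intro A B
    rw [← max_add_add_left, max_le_iff]
  rw [score, h, ← max_sub_sub_right, ← max_add_add_right, h, h, and_assoc]
  constructor <;> rintro ⟨h1, h2, h3, h4⟩ <;> refine ⟨?_, ?_, ?_, ?_⟩ <;> linarith

/-- Each of the four linear conditions is a maximum over the pairs that are too far apart. The field
`le` makes the four numbers sufficient, and the attaining pairs make them necessary. -/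
theorem Corners.score_le_iff {a : ℕ} {P U : ℕ → ℝ} {μ pp pm mp mm : ℝ}
    (H : Corners a (a + 1) P U μ pp pm mp mm) {c x y : ℝ} : score pp pm mp mm c x y ≤ μ ↔
      ∀ k h, k ≤ a → h ≤ a → P h + U k ≤ μ ∨
        max (P k - x) (U k + x) + c + max (P h - y) (U h + y) ≤ μ := by
  rw [WDoap.score_le_iff]
  constructor
  · rintro ⟨h1, h2, h3, h4⟩ k h hk hh
    rcases le_or_gt (P h + U k) μ with hb | hb
    · exact .inl hb
    · right
      obtain ⟨h5, h6, h7, h8⟩ := H.le k h (by omega) hh hb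
      rcases max_choice (P k - x) (U k + x) with h | h <;> rw [h] <;>
      rcases max_choice (P ‹ℕ› - y) (U ‹ℕ› + y) with h | h <;> rw [h] <;> linarith
  · intro hall
    have key : ∀ k h, k ≤ a → h ≤ a → μ < P h + U k →
        (P k - x) + c + (P h - y) ≤ μ ∧ (U k + x) + c + (P h - y) ≤ μ ∧
        (P k - x) + c + (U h + y) ≤ μ ∧ (U k + x) + c + (U h + y) ≤ μ := by
      intro k h hk hh hb
      rcases hall k h hk hh with h1 | h1
      · linarith
      · have h2 := le_max_left (P k - x) (U k + x)
        have h3 := le_max_right (P k - x) (U k + x)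
        have h4 := le_max_left (P h - y) (U h + y)
        have h5 := le_max_right (P h - y) (U h + y)
        refine ⟨?_, ?_, ?_, ?_⟩ <;> linarith
    obtain ⟨k1, l1, a1, b1, c1, d1⟩ := H.pp_le
    obtain ⟨k2, l2, a2, b2, c2, d2⟩ := H.mp_le
    obtain ⟨k3, l3, a3, b3, c3, d3⟩ := H.pm_le
    obtain ⟨k4, l4, a4, b4, c4, d4⟩ := H.mm_le
    refine ⟨?_, ?_, ?_, ?_⟩
    · linarith [(key k1 l1 a1 b1 c1).1]
    · linarith [(key k2 l2 a2 b2 c2).2.1]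
    · linarith [(key k3 l3 a3 b3 c3).2.2.1]
    · linarith [(key k4 l4 a4 b4 c4).2.2.2]

/-- In a row, some entry next to the threshold is optimal. -/
theorem exists_score_le {a r b j : ℕ} {X C : ℕ → ℝ} {pp pm mp mm x μ : ℝ}
    (hX : ∀ k l, k ≤ l → l ≤ a → X k ≤ X l)
    (hC : ∀ k l, r < k → k ≤ l → l ≤ a → C l ≤ C k + (X l - X k) ∧ C k ≤ C l + (X l - X k))
    (hba : b ≤ a + 1) (hb : ∀ b' < b, max (pm - x) (mm + x) + (X b' + X b') ≤ max (pp - x) (mp + x))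
    (hb' : b ≤ a → max (pp - x) (mp + x) < max (pm - x) (mm + x) + (X b + X b))
    (hrj : r < j) (hj : j ≤ a) (hs : score pp pm mp mm (C j) x (X j) ≤ μ) :
    ∃ j', (j' = b - 1 ∨ j' = b ∨ j' = r + 1) ∧ r < j' ∧ j' ≤ a ∧
      score pp pm mp mm (C j') x (X j') ≤ μ := by
  unfold score at *
  set A := max (pp - x) (mp + x)
  set B := max (pm - x) (mm + x)
  have hs1 := (add_le_add_right (le_max_left (A - X j) (B + X j)) (C j)).trans hs
  have hs2 := (add_le_add_right (le_max_right (A - X j) (B + X j)) (C j)).trans hs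
  rcases lt_or_ge j b with h | h
  · refine ⟨b - 1, .inl rfl, by omega, by omega, ?_⟩
    have h1 := hX j (b - 1) (by omega) (by omega)
    have h2 := hC j (b - 1) hrj (by omega) (by omega)
    have h3 := hb (b - 1) (by omega)
    rw [max_eq_left (by linarith)]
    linarith
  -- From the threshold on, the rising branch dominates and `C + X` is nondecreasing, so the first
  -- admissible column is best: `b`, or `r + 1` if the threshold is not to the right of `r`.
  · have key : ∀ j', r < j' → b ≤ j' → j' ≤ j → C j' + max (A - X j') (B + X j') ≤ μ := by
      intro j' h0 h1 h2
      have h3 := hX j' j h2 hj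
      have h4 := hC j' j h0 h2 hj
      have h5 := hb' (by omega)
      have h6 := hX b j' h1 (by omega)
      rw [max_eq_right (by linarith)]
      linarith
    rcases lt_or_ge r b with h1 | h1
    · exact ⟨b, .inr (.inl rfl), h1, by omega, key b h1 le_rfl h⟩
    · exact ⟨r + 1, .inr (.inr rfl), by omega, by omega, key _ (by omega) (by omega) (by omega)⟩

/-- The threshold is monotone in the row. -/
theorem threshold_mono {pp pm mp mm x y z : ℝ}
    (h : (pp + mm ≤ pm + mp ∧ x ≤ y) ∨ (pm + mp ≤ pp + mm ∧ y ≤ x))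
    (hx : max (pm - x) (mm + x) + z ≤ max (pp - x) (mp + x)) :
    max (pm - y) (mm + y) + z ≤ max (pp - y) (mp + y) := by
  -- As a function of `x`, the difference of the two maxima has slope `0` outside its breakpoints
  -- `(pp - mp) / 2` and `(pm - mm) / 2`, and slope `2` or `-2` between them. The order of the
  -- breakpoints decides the sign.
  have h1 := le_max_left (pp - y) (mp + y)
  have h2 := le_max_right (pp - y) (mp + y)
  have h3 := le_max_left (pm - x) (mm + x)
  have h4 := le_max_right (pm - x) (mm + x)
  rcases max_choice (pm - y) (mm + y) with h5 | h5 <;> rw [h5] <;>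
  rcases max_choice (pp - x) (mp + x) with h6 | h6 <;> rw [h6] at hx <;>
  rcases h with ⟨h7, h8⟩ | ⟨h7, h8⟩ <;> linarith

/-! ### Passing between vertices and clusters -/

namespace Clusters

variable (H : Clusters I g (I.n + 1) a ix P U) (hg : 0 ≤ g)
include H

/-- A bound for the approximate intervals is valid for the true ones. -/
theorem DLe_of_forall {r j : ℕ} {μ : ℝ} (h : ∀ k h, k ≤ a → h ≤ a → P h + U k ≤ μ ∨
    max (P k - I.pos (ix r)) (U k + I.pos (ix r)) + I.cost (ix r) (ix j) +
      max (P h - I.pos (ix j)) (U h + I.pos (ix j)) ≤ μ) : I.DLe (ix r) (ix j) μ := by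
  intro k l hkl hl
  obtain ⟨b, hb, -, -, h1, h2⟩ := H.cover k (by omega)
  obtain ⟨b', hb', -, -, h3, h4⟩ := H.cover l (by omega)
  rcases h b b' hb hb' with h5 | h5
  · left; linarith
  · right
    refine le_trans ?_ h5
    gcongr

/-- For a tested value below the length of the path, this makes the pair `(0, a)` too far apart, as
`Corners.init` requires. -/
theorem len_le (hU : ∀ b b', b ≤ b' → b' ≤ a → U b' ≤ U b) : I.len ≤ P a + U 0 := by
  obtain ⟨b, hb, -, -, h1, h2⟩ := H.cover 0 (by omega)
  obtain ⟨b', hb', -, -, h3, h4⟩ := H.cover I.n (by omega)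
  have h5 := hU 0 b (Nat.zero_le _) hb
  have h6 := H.P_mono hb' le_rfl
  have h7 := I.nodeWt_nonneg 0
  have h8 := I.nodeWt_nonneg I.n
  unfold left at h2
  unfold right at h3
  rw [pos_zero] at h2
  unfold len
  linarith

include hg

/-- Some shortcut between representatives is almost as good as a given one. -/
theorem exists_of_DLe {i j : ℕ} {μ : ℝ} (hij : i < j) (hj : j ≤ I.n) (hD : I.DLe i j μ) :
    I.len - g ≤ μ ∨ ∃ r s, r < s ∧ s ≤ a ∧ ∀ k h, k ≤ a → h ≤ a → P h + U k ≤ μ + 6 * g ∨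
      max (P k - I.pos (ix r)) (U k + I.pos (ix r)) + I.cost (ix r) (ix s) +
      max (P h - I.pos (ix s)) (U h + I.pos (ix s)) ≤ μ + 6 * g := by
  obtain ⟨r, hr, h1, h2, -, -⟩ := H.cover i (by omega)
  obtain ⟨s, hs, h3, h4, -, -⟩ := H.cover j (by omega)
  have h5 := I.pos_lt hij hj
  rcases lt_trichotomy r s with h | rfl | h
  · right
    refine ⟨r, s, h, hs, fun k l hk hl => ?_⟩
    -- The total loss is `6 g`: moving both end points changes the weight by at most `2 g`, and each
    -- of the two maxima loses `g` from its interval and `g` from its end point.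
    have h6 := I.cost_le_cost hij hj (H.ix_lt_ix hg h hs)
      (Nat.lt_succ_iff.1 (H.ix_lt s hs))
    rw [abs_of_nonneg (by linarith), abs_of_nonneg (by linarith)] at h6
    obtain ⟨k', hk', h7, h8⟩ := H.exists_interval hg hk
    obtain ⟨l', hl', h9, h10⟩ := H.exists_interval hg hl
    rcases hD.all (k := k') (h := l') (by omega) (by omega) with h11 | h11
    · left; linarith
    · right
      have e1 : max (P k - I.pos (ix r)) (U k + I.pos (ix r)) ≤
          max (I.right k' - I.pos i) (I.left k' + I.pos i) + 2 * g := by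
        rw [← max_add_add_right]
        exact max_le_max (by linarith) (by linarith)
      have e2 : max (P l - I.pos (ix s)) (U l + I.pos (ix s)) ≤
          max (I.right l' - I.pos j) (I.left l' + I.pos j) + 2 * g := by
        rw [← max_add_add_right]
        exact max_le_max (by linarith) (by linarith)
      linarith
  -- Both end points lie in one cluster, so the shortcut is nearly useless.
  · left
    exact hD.len_sub_le hij hj (by linarith)
  · linarith [H.gap_lt hg h hr]

end Clusters

end WDoap

namespace RealRAM

/-! ## The program -/

/-- The `b`-th entry of the real array `arr` for the integer register `b`. -/
abbrev cell (arr b : ℕ) : RExpr := .get arr (.reg b)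

/-- Position of the first vertex of the cluster `e`. -/
abbrev repPos (e : NExpr) : RExpr := .get 2 (.get 0 e)

/-- Positions of the vertices, in array `2`; a longest edge, in integer register `1`, and its length,
in real register `2`. -/
def scanLoop : Prog := .loop (.natLe (.add (.reg 3) (.lit 2)) (.reg 0)) <|
  .seq (.cond (.realLe (.reg 2) (cell 0 3)) (.seq (.setReal 2 (cell 0 3)) (.setNat 1 (.reg 3)))
    .nop) <|
  .seq (.setReal 1 (.add (.reg 1) (cell 0 3))) <|
  .seq (.setNat 3 (.add (.reg 3) (.lit 1))) <|
  .storeReal 2 (.reg 3) (.reg 1)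

/-- The first solution, the cluster size (real register `3`), and an upper bound on the optimum (real
register `5`). -/
def estimateStep : Prog :=
  .seq (.setNat 2 (.add (.reg 1) (.lit 1))) <|
  .seq (.setReal 6 (.sub (.reg 1) (.reg 2))) <|
  .seq (.cond (.realLe (.reg 2) (.oracle (.reg 1) (.reg 2))) .nop
    (.setReal 2 (.oracle (.reg 1) (.reg 2)))) <|
  .seq (.setReal 6 (.add (.add (.reg 6) (.reg 6)) (.reg 2))) <|
  .seq (.setReal 3 (.div (.mul (.reg 0) (.reg 6)) (.lit 64))) <|
  .seq (.cond (.realLe (.reg 1) (.reg 6)) (.setReal 5 (.reg 1)) (.setReal 5 (.reg 6))) <|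
  .setNat 3 (.lit 1)

/-- Clusters: first vertices in integer array `0`, intervals in real arrays `3` and `4`. -/
def clusterLoop : Prog := .loop (.natLe (.add (.reg 3) (.lit 1)) (.reg 0)) <|
  .seq (.cond (.realLe (cell 2 3) (.add (repPos (.reg 5)) (.reg 3))) .nop <|
    .seq (.setNat 5 (.add (.reg 5) (.lit 1))) <|
    .seq (.storeNat 0 (.reg 5) (.reg 3)) <|
    .setReal 8 (.sub (cell 1 3) (cell 2 3))) <|
  .seq (maxReal 7 (.add (cell 2 3) (cell 1 3))) <|
  .seq (maxReal 8 (.sub (cell 1 3) (cell 2 3))) <|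
  .seq (.storeReal 3 (.reg 5) (.reg 7)) <|
  .seq (.storeReal 4 (.reg 5) (.reg 8)) <|
  .setNat 3 (.add (.reg 3) (.lit 1))

/-- Suffix maxima of the real array `4`. -/
def suffixLoop : Prog := .loop (.natLe (.lit 1) (.reg 3)) <|
  .seq (.setNat 3 (.sub (.reg 3) (.lit 1))) <|
  .seq (maxReal 8 (cell 4 3)) <|
  .storeReal 4 (.reg 3) (.reg 8)

/-- Initialization of the test for the value in real register `6`. -/
def cornerInit : Prog :=
  .seq (.setReal 6 (.div (.add (.reg 4) (.reg 5)) (.lit 2))) <|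
  .seq (.setNat 3 (.lit 0)) <|
  .seq (.setNat 4 (.lit 0)) <|
  .seq (.setReal 9 (.add (cell 3 3) (cell 3 5))) <|
  .seq (.setReal 10 (.add (cell 3 3) (cell 4 5))) <|
  .seq (.setReal 11 (.add (cell 4 3) (cell 3 5))) <|
  .setReal 12 (.add (cell 4 3) (cell 4 5))

/-- The four numbers of the test, in the real registers `9`, `10`, `11`, `12`. -/
def cornerLoop : Prog := .loop (.and (.natLe (.reg 3) (.reg 5)) (.natLe (.reg 4) (.reg 5))) <|
  .cond (.realLe (.add (cell 3 4) (cell 4 3)) (.reg 6)) (.setNat 4 (.add (.reg 4) (.lit 1))) <|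
  .seq (maxReal 9 (.add (cell 3 3) (cell 3 5))) <|
  .seq (maxReal 10 (.add (cell 3 3) (cell 4 4))) <|
  .seq (maxReal 11 (.add (cell 4 3) (cell 3 5))) <|
  .seq (maxReal 12 (.add (cell 4 3) (cell 4 4))) <|
  .setNat 3 (.add (.reg 3) (.lit 1))

/-- Record the shortcut between the clusters in integer register `6` and `e`, if it is good. -/
def check (e : NExpr) : Prog :=
  .cond (.and (.and (.natLe (.add (.reg 6) (.lit 1)) e) (.natLe e (.reg 5)))
    (.and (.realLe (.add (.oracle (.get 0 (.reg 6)) (.get 0 e)) (.sub (.reg 13) (repPos e)))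
        (.reg 6))
      (.realLe (.add (.oracle (.get 0 (.reg 6)) (.get 0 e)) (.add (.reg 14) (repPos e)))
        (.reg 6))))
    (.seq (.setNat 1 (.get 0 (.reg 6))) <|
      .seq (.setNat 2 (.get 0 e)) <|
      .setReal 5 (.reg 6)) .nop

/-- The threshold of the row in integer register `6` is between the real registers `13`, `14`. -/
def rowStep : Prog :=
  .seq (.cond (.realLe (.add (.reg 9) (.reg 12)) (.add (.reg 10) (.reg 11)))
    (.setNat 6 (.reg 3)) (.setNat 6 (.sub (.reg 5) (.reg 3)))) <|
  .seq (.setReal 13 (.sub (.reg 9) (repPos (.reg 6)))) <|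
  .seq (maxReal 13 (.add (.reg 11) (repPos (.reg 6)))) <|
  .seq (.setReal 14 (.sub (.reg 10) (repPos (.reg 6)))) <|
  maxReal 14 (.add (.reg 12) (repPos (.reg 6)))

/-- Move the column pointer or, at the threshold, check the candidates of the row. -/
def columnStep : Prog :=
  .cond (.and (.natLe (.reg 4) (.reg 5))
      (.realLe (.add (.reg 14) (.add (repPos (.reg 4)) (repPos (.reg 4)))) (.reg 13)))
    (.setNat 4 (.add (.reg 4) (.lit 1))) <|
    .seq (check (.sub (.reg 4) (.lit 1))) <|
    .seq (check (.reg 4)) <|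
    .seq (check (.add (.reg 6) (.lit 1))) <|
    .setNat 3 (.add (.reg 3) (.lit 1))

/-- The search for a good shortcut. -/
def searchLoop : Prog := .loop (.natLe (.reg 3) (.reg 5)) (.seq rowStep columnStep)

/-- Binary search for the optimum. -/
def bisectLoop : Prog := .loop (.not (.realLe (.sub (.reg 5) (.reg 4)) (.reg 3))) <|
  .seq cornerInit <|
  .seq cornerLoop <|
  .seq (.seq (.setNat 3 (.lit 0)) (.setNat 4 (.lit 0))) <|
  .seq searchLoop <|
  .cond (.realLe (.reg 5) (.reg 6)) .nop (.setReal 4 (.reg 6))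

/-- The approximation algorithm. -/
def algorithm : Prog :=
  .seq (.setReal 2 (.get 0 (.lit 0))) <|
  .seq scanLoop <|
  .seq estimateStep <|
  .seq clusterLoop <|
  .seq (.setNat 3 (.reg 5)) <|
  .seq suffixLoop bisectLoop

end RealRAM

/-! ### Maintaining the clusters -/

namespace WDoap

variable {I : WDoap} {g : ℝ} {a v : ℕ} {ix : ℕ → ℕ} {P U : ℕ → ℝ}

/-- The first vertex forms a cluster. -/
theorem Clusters.init (hg : 0 ≤ g) (h0 : ix 0 = 0) (hP : P 0 = 0) (hU : U 0 = 0) :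
    Clusters I g 1 0 ix P U := by
  have hw := I.nodeWt_le (Nat.zero_le I.n)
  have hw' := I.nodeWt_nonneg 0
  rw [pos_zero] at hw
  have hw0 : I.nodeWt 0 = 0 := le_antisymm hw.1 hw'
  have hr : I.right 0 = 0 := by simp [right, hw0]
  have hl : I.left 0 = 0 := by simp [left, hw0]
  constructor
  · intro b hb; obtain rfl : b = 0 := by omega
    simp [h0]
  · intro b hb; omega
  · intro b hb; omega
  · intro u hu; obtain rfl : u = 0 := by omega
    exact ⟨0, le_rfl, by simp [h0], by simp [h0, hg], by rw [hr, hP], by rw [hl, hU]⟩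
  · intro b hb; obtain rfl : b = 0 := by omega
    exact ⟨0, by omega, by rw [hr, hP], by simp [h0, hg]⟩
  · intro b hb; obtain rfl : b = 0 := by omega
    exact ⟨0, by omega, by rw [hl, hU], by simp [h0]⟩

/-- The next vertex joins the last cluster. -/
theorem Clusters.step_old (H : Clusters I g v a ix P U) (hv : I.pos v ≤ I.pos (ix a) + g) :
    Clusters I g (v + 1) a ix (Function.update P a (max (P a) (I.right v)))
      (Function.update U a (max (U a) (I.left v))) := by
  have hP : ∀ b, P b ≤ Function.update P a (max (P a) (I.right v)) b := by
    intro b; rw [Function.update_apply]; split_ifs with h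
    · rw [h]; exact le_max_left _ _
    · rfl
  have hU : ∀ b, U b ≤ Function.update U a (max (U a) (I.left v)) b := by
    intro b; rw [Function.update_apply]; split_ifs with h
    · rw [h]; exact le_max_left _ _
    · rfl
  have hav := I.pos_mono (H.ix_lt a le_rfl).le
  constructor
  · intro b hb; have := H.ix_lt b hb; omega
  · exact H.gap
  · intro b hb
    rw [Function.update_of_ne (by omega)]
    exact (H.P_le b hb).trans (hP _)
  · intro u hu
    rcases Nat.lt_succ_iff_lt_or_eq.1 hu with h | rfl
    · obtain ⟨b, hb, h1, h2, h3, h4⟩ := H.cover u h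
      exact ⟨b, hb, h1, h2, h3.trans (hP b), h4.trans (hU b)⟩
    · exact ⟨a, le_rfl, hav, hv, by simp, by simp⟩
  · intro b hb
    rw [Function.update_apply]; split_ifs with h
    · subst h
      rcases max_choice (P b) (I.right v) with h | h <;> rw [h]
      · obtain ⟨k, hk, h1, h2⟩ := H.P_eq b hb
        exact ⟨k, by omega, h1, h2⟩
      · exact ⟨v, by omega, rfl, hv⟩
    · obtain ⟨k, hk, h1, h2⟩ := H.P_eq b hb
      exact ⟨k, by omega, h1, h2⟩
  · intro b hb
    rw [Function.update_apply]; split_ifs with h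
    · subst h
      rcases max_choice (U b) (I.left v) with h | h <;> rw [h]
      · obtain ⟨k, hk, h1, h2⟩ := H.U_eq b hb
        exact ⟨k, by omega, h1, h2⟩
      · exact ⟨v, by omega, rfl, hav⟩
    · obtain ⟨k, hk, h1, h2⟩ := H.U_eq b hb
      exact ⟨k, by omega, h1, h2⟩

/-- The next vertex starts a new cluster. -/
theorem Clusters.step_new (hg : 0 ≤ g) (H : Clusters I g v a ix P U)
    (hv : I.pos (ix a) + g < I.pos v) :
    Clusters I g (v + 1) (a + 1) (Function.update ix (a + 1) v)
      (Function.update P (a + 1) (max (P a) (I.right v)))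
      (Function.update U (a + 1) (I.left v)) := by
  have hne : ∀ {b}, b ≤ a → b ≠ a + 1 := by intro b hb; omega
  constructor
  · intro b hb
    rw [Function.update_apply]; split_ifs with h
    · omega
    · have := H.ix_lt b (by omega); omega
  · intro b hb
    rw [Function.update_of_ne (by omega) v ix, Function.update_apply]; split_ifs with h
    · obtain rfl : b = a := by omega
      exact hv
    · exact H.gap b (by omega)
  · intro b hb
    rw [Function.update_of_ne (by omega), Function.update_apply]; split_ifs with h
    · obtain rfl : b = a := by omega
      exact le_max_left _ _
    · exact H.P_le b (by omega)
  · intro u hu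
    rcases Nat.lt_succ_iff_lt_or_eq.1 hu with h | rfl
    · obtain ⟨b, hb, h1⟩ := H.cover u h
      refine ⟨b, by omega, ?_⟩
      rw [Function.update_of_ne (hne hb), Function.update_of_ne (hne hb),
        Function.update_of_ne (hne hb)]
      exact h1
    · exact ⟨a + 1, le_rfl, by simp, by simp [hg], by simp, by simp⟩
  · intro b hb
    rcases Nat.lt_succ_iff_lt_or_eq.1 (Nat.lt_succ_of_le hb) with h | rfl
    · have hb' : b ≤ a := by omega
      rw [Function.update_of_ne (hne hb'), Function.update_of_ne (hne hb')]
      obtain ⟨k, hk, h1, h2⟩ := H.P_eq b hb'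
      exact ⟨k, by omega, h1, h2⟩
    -- `P` is a running maximum, so its witness may lie in an earlier cluster, whereas `U` restarts
    -- with `v`. The later pass from the right turns `U` into suffix maxima.
    · rw [Function.update_self, Function.update_self]
      rcases max_choice (P a) (I.right v) with h | h <;> rw [h]
      · obtain ⟨k, hk, h1, h2⟩ := H.P_eq a le_rfl
        exact ⟨k, by omega, h1, by linarith⟩
      · exact ⟨v, by omega, rfl, by linarith⟩
  · intro b hb
    rcases Nat.lt_succ_iff_lt_or_eq.1 (Nat.lt_succ_of_le hb) with h | rfl
    · have hb' : b ≤ a := by omega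
      rw [Function.update_of_ne (hne hb'), Function.update_of_ne (hne hb')]
      obtain ⟨k, hk, h1, h2⟩ := H.U_eq b hb'
      exact ⟨k, by omega, h1, h2⟩
    · rw [Function.update_self, Function.update_self]
      exact ⟨v, by omega, rfl, le_rfl⟩

/-- A witness for `U` only has to lie to the right of the first vertex of the cluster, so one from a
later cluster is admissible. -/
theorem Clusters.step_suffix (hg : 0 ≤ g) (H : Clusters I g v a ix P U) {k : ℕ} (hk : k < a) :
    Clusters I g v a ix P (Function.update U k (max (U (k + 1)) (U k))) := by
  refine ⟨H.ix_lt, H.gap, H.P_le, ?_, H.P_eq, ?_⟩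
  · intro u hu
    obtain ⟨b, hb, h1, h2, h3, h4⟩ := H.cover u hu
    refine ⟨b, hb, h1, h2, h3, ?_⟩
    rw [Function.update_apply]; split_ifs with h
    · subst h; exact le_max_of_le_right h4
    · exact h4
  · intro b hb
    rw [Function.update_apply]; split_ifs with h
    · subst h
      rcases max_choice (U (b + 1)) (U b) with h | h <;> rw [h]
      · obtain ⟨l, hl, h1, h2⟩ := H.U_eq (b + 1) hk
        exact ⟨l, hl, h1, by linarith [H.gap b hk]⟩
      · exact H.U_eq b hb
    · exact H.U_eq b hb

theorem antitone_step_suffix {k : ℕ} (hU : ∀ b, k + 1 ≤ b → b < a → U (b + 1) ≤ U b) :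
    ∀ b, k ≤ b → b < a → Function.update U k (max (U (k + 1)) (U k)) (b + 1) ≤
      Function.update U k (max (U (k + 1)) (U k)) b := by
  intro b hb hba
  rw [Function.update_of_ne (by omega), Function.update_apply]; split_ifs with h
  · subst h; exact le_max_left _ _
  · exact hU b (by omega) hba

end WDoap

namespace RealRAM

open WDoap

attribute [simp] wp wp_maxReal NExpr.eval NExpr.Safe RExpr.eval RExpr.Safe Test.Holds Test.Safe
  natReg_setNat realReg_setNat natArr_setNat realArr_setNat
  natReg_setReal realReg_setReal natArr_setReal realArr_setReal
  natReg_storeNat realReg_storeNat natArr_storeNat realArr_storeNat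
  natReg_storeReal realReg_storeReal natArr_storeReal realArr_storeReal

variable {I : WDoap} {S : ℕ} {ε : ℝ}

/-! ## Correctness: positions and the first estimate -/

/-- The input, and the memory cells that the first part of the program does not touch. -/
structure Fresh (I : WDoap) (ε : ℝ) (s : State) : Prop where
  size : s.natReg 0 = I.n + 1
  eps : s.realReg 0 = ε
  edges : s.realArr 0 = I.edgeWt
  nodes : s.realArr 1 = I.nodeWt
  last : s.natReg 5 = 0
  lo : s.realReg 4 = 0
  r7 : s.realReg 7 = 0
  r8 : s.realReg 8 = 0
  ix : s.natArr 0 0 = 0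
  P : s.realArr 3 0 = 0
  U : s.realArr 4 0 = 0

theorem fresh_input : Fresh I ε (input I ε) where
  size := rfl
  eps := rfl
  edges := rfl
  nodes := rfl
  last := rfl
  lo := rfl
  r7 := rfl
  r8 := rfl
  ix := rfl
  P := rfl
  U := rfl

/-- Invariant of `scanLoop` after `k` edges. The first edge is the initial candidate for a longest
one. -/
structure Scanned (I : WDoap) (ε : ℝ) (k : ℕ) (s : State) : Prop where
  fresh : Fresh I ε s
  k_le : k ≤ I.n
  k_eq : s.natReg 3 = k
  m_lt : s.natReg 1 < I.n
  r1 : s.realReg 1 = I.pos k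
  r2 : s.realReg 2 = I.edgeWt (s.natReg 1)
  max : ∀ l < k, I.edgeWt l ≤ s.realReg 2
  pos : ∀ l ≤ k, s.realArr 2 l = I.pos l

theorem exec_scanLoop (hS : I.n + 3 ≤ S) {s : State} (hs : Scanned I ε 0 s) :
    Exec I S scanLoop s (scanLoop.iter * (I.n + 1)) (Scanned I ε I.n) := by
  refine Exec.flatLoop (fun K s => ∃ k, K + k = I.n ∧ Scanned I ε k s) ?_ ?_ ?_ ⟨0, by simp, hs⟩
  · rintro K s ⟨k, hK, H⟩
    simp [H.fresh.size, H.k_eq]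
    omega
  · rintro K s ⟨k, hK, ⟨⟨size, eps, edges, nodes, last, lo, r7, r8, ix, P, U⟩, k_le, k_eq, m_lt, r1,
      r2, max, pos⟩⟩ hb
    simp only [Test.Holds, NExpr.eval, k_eq, size] at hb
    have hk : k < I.n := by omega
    -- Both branches of the body reduce to this description of the next state.
    have key : ∀ s' : State, Fresh I ε s' → s'.natReg 3 = k + 1 → s'.natReg 1 < I.n →
        s'.realReg 1 = I.pos (k + 1) → s'.realReg 2 = I.edgeWt (s'.natReg 1) →
        I.edgeWt k ≤ s'.realReg 2 → s.realReg 2 ≤ s'.realReg 2 →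
        (s'.realArr 2 = Function.update (s.realArr 2) (k + 1) (I.pos (k + 1))) →
        ∃ k' < K, ∃ k, k' + k = I.n ∧ Scanned I ε k s' := by
      intro s' h1 h2 h3 h4 h5 h6 h7 h8
      refine ⟨K - 1, by omega, k + 1, by omega, h1, by omega, h2, h3, h4, h5, ?_, ?_⟩
      · intro l hl
        rcases Nat.lt_succ_iff_lt_or_eq.1 hl with h | rfl
        · exact (max l h).trans h7
        · exact h6
      · intro l hl
        rw [h8, Function.update_apply]; split_ifs with h
        · rw [h]
        · exact pos l (by omega)
    have e1 : k < S := by omega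
    have e2 : k + 1 < S := by omega
    have e3 : 1 ≤ S := by omega
    simp [k_eq, edges, r1, r2, e1, e1.le, e2, e3, ← I.pos_succ]
    refine ⟨fun hle => key _ ?_ ?_ ?_ ?_ ?_ ?_ ?_ ?_, fun hlt => key _ ?_ ?_ ?_ ?_ ?_ ?_ ?_ ?_⟩
    all_goals first
      | constructor <;> simp [*]
      | simp [*]
    exact hlt.le
  · rintro K s ⟨k, hK, H⟩ hb
    simp only [Test.Holds, NExpr.eval, H.fresh.size, H.k_eq] at hb
    obtain rfl : k = I.n := by omega
    exact H

/-- A shortcut, and a bound for it that is at most `c`. -/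
structure Solution (I : WDoap) (c : ℝ) (i j : ℕ) (hi : ℝ) : Prop where
  lt : i < j
  le_n : j ≤ I.n
  bound : I.DLe i j hi
  le : hi ≤ c

/-- After the first phase: a solution of value at most `hi`, and a cluster size `g`. -/
structure Estimated (I : WDoap) (ε g : ℝ) (a k : ℕ) (s : State) : Prop where
  size : s.natReg 0 = I.n + 1
  nodes : s.realArr 1 = I.nodeWt
  pos : ∀ l ≤ I.n, s.realArr 2 l = I.pos l
  lo : s.realReg 4 = 0
  g_eq : s.realReg 3 = g
  sol : Solution I I.len (s.natReg 1) (s.natReg 2) (s.realReg 5)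
  hi_mul_le : ε * s.realReg 5 ≤ 64 * g
  last : s.natReg 5 = a
  k_eq : s.natReg 3 = k
  k_le : k ≤ I.n + 1
  clusters : Clusters I g k a (s.natArr 0) (s.realArr 3) (s.realArr 4)
  r7 : s.realReg 7 = s.realArr 3 a
  r8 : s.realReg 8 = s.realArr 4 a

/-- The cluster size is small compared with the optimum and large compared with the path. -/
structure GoodSize (I : WDoap) (ε g : ℝ) : Prop where
  nonneg : 0 ≤ g
  le : ∀ i j μ, i < j → j ≤ I.n → I.DLe i j μ → 7 * g ≤ ε * μ
  ge : ∃ m < I.n, I.rest m * ε ≤ 64 * g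
  zero : g = 0 → I.n = 1

/-- Bisection loses `7 g`, and the estimate is at most `9` times the optimum. The divisor `64`
suffices because `7 * 9 = 63`. -/
theorem goodSize (hε : 0 < ε) {m : ℕ} (hm : m < I.n)
    (hmax : ∀ k < I.n, I.edgeWt k ≤ I.edgeWt m) : GoodSize I ε (ε * I.estimate m / 64) where
  nonneg := by have := I.estimate_nonneg hm; positivity
  le := by
    intro i j μ hij hj H
    have h1 := I.estimate_le hm hmax hij hj H
    have h2 := H.nonneg
    have h3 := mul_le_mul_of_nonneg_left h1 hε.le
    have h4 := mul_nonneg hε.le h2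
    linarith
  ge := ⟨m, hm, by
    have := mul_le_mul_of_nonneg_left (I.rest_le_estimate hm) hε.le
    linarith⟩
  zero := by
    intro h
    have h1 : I.estimate m = 0 := by
      have : ε * I.estimate m = 0 := by linarith
      exact (mul_eq_zero.1 this).resolve_left hε.ne'
    exact I.eq_of_rest_eq_zero hm (le_antisymm (h1 ▸ I.rest_le_estimate hm) (I.rest_nonneg hm))

theorem exec_estimateStep (hS : I.n + 3 ≤ S) (hε : 0 < ε) {s : State} (hs : Scanned I ε I.n s) :
    Exec I S estimateStep s estimateStep.bound
      (fun s => ∃ g, GoodSize I ε g ∧ Estimated I ε g 0 1 s) := by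
  obtain ⟨⟨size, eps, edges, nodes, last, lo, r7, r8, ix, P, U⟩, k_le, k_eq, m_lt, r1,
      r2, max, pos⟩ := hs
  apply Exec.of_wp
  have key : ∀ s' : State, s'.natReg 0 = I.n + 1 → s'.realArr 1 = I.nodeWt →
      s'.realArr 2 = s.realArr 2 → s'.realReg 4 = 0 → s'.natReg 1 = s.natReg 1 →
      s'.natReg 2 = s.natReg 1 + 1 → s'.natReg 5 = 0 → s'.natReg 3 = 1 → s'.realReg 7 = 0 →
      s'.realReg 8 = 0 → s'.natArr 0 0 = 0 → s'.realArr 3 0 = 0 → s'.realArr 4 0 = 0 →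
      s'.realReg 3 = ε * I.estimate (s.natReg 1) / 64 →
      s'.realReg 5 = min I.len (I.estimate (s.natReg 1)) →
      ∃ g, GoodSize I ε g ∧ Estimated I ε g 0 1 s' := by
    intro s' h1 h2 h3 h4 h5 h6 h7 h8 h9 h10 h11 h12 h13 h14 h15
    -- Register `1` holds a longest edge once the scan is complete.
    have hg := goodSize hε m_lt (fun k hk => r2 ▸ max k hk)
    refine ⟨_, hg, ?_⟩
    constructor
    · exact h1
    · exact h2
    · rw [h3]; exact pos
    · exact h4
    · exact h14
    · rw [h5, h6, h15]
      refine ⟨by omega, by omega, ?_, min_le_left _ _⟩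
      rcases min_choice I.len (I.estimate (s.natReg 1)) with h | h <;> rw [h]
      · exact I.DLe_len _ _
      · exact I.DLe_estimate m_lt
    · rw [h15]
      have := mul_le_mul_of_nonneg_left (min_le_right I.len (I.estimate (s.natReg 1))) hε.le
      linarith
    · exact h7
    · exact h8
    · omega
    · exact Clusters.init hg.nonneg h11 h12 h13
    · rw [h9, h12]
    · rw [h10, h13]
  have e1 : s.natReg 1 < S := by omega
  have e2 : s.natReg 1 + 1 ≤ S := by omega
  have e3 : 1 ≤ S := by omega
  have e4 : s.natReg 1 + 1 < I.n + 1 := by omega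
  have e6 : answer I (s.natReg 1) (s.natReg 1 + 1) = I.cost (s.natReg 1) (s.natReg 1 + 1) := rfl
  have e7 : I.pos I.n = I.len := rfl
  have hA : I.estimate (s.natReg 1) = I.len - I.edgeWt (s.natReg 1) +
    (I.len - I.edgeWt (s.natReg 1)) +
      min (I.edgeWt (s.natReg 1)) (I.cost (s.natReg 1) (s.natReg 1 + 1)) := by
    rw [WDoap.estimate, WDoap.rest]; ring
  simp [estimateStep, eps, r1, r2, e1.le, e2, e3, e4, e6, e7, WDoap.N]
  refine ⟨m_lt.le, fun h1 => ?_, fun h1 => ⟨m_lt.le, ?_⟩⟩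
  · rw [min_eq_left h1] at hA
    refine ⟨fun h2 => key _ ?_ ?_ ?_ ?_ ?_ ?_ ?_ ?_ ?_ ?_ ?_ ?_ ?_ ?_ ?_,
      fun h2 => key _ ?_ ?_ ?_ ?_ ?_ ?_ ?_ ?_ ?_ ?_ ?_ ?_ ?_ ?_ ?_⟩
    all_goals simp [*]
    all_goals linarith
  · rw [min_eq_right h1.le] at hA
    refine ⟨fun h2 => key _ ?_ ?_ ?_ ?_ ?_ ?_ ?_ ?_ ?_ ?_ ?_ ?_ ?_ ?_ ?_,
      fun h2 => key _ ?_ ?_ ?_ ?_ ?_ ?_ ?_ ?_ ?_ ?_ ?_ ?_ ?_ ?_ ?_⟩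
    all_goals simp [*]
    all_goals linarith

theorem exec_clusterLoop (hS : I.n + 3 ≤ S) {g : ℝ} (hg : 0 ≤ g) {s : State}
    (hs : Estimated I ε g 0 1 s) : Exec I S clusterLoop s (clusterLoop.iter * (I.n + 1))
      (fun s => ∃ a, Estimated I ε g a (I.n + 1) s) := by
  refine Exec.flatLoop (fun K s => ∃ k a, K + k = I.n + 1 ∧ Estimated I ε g a k s) ?_ ?_ ?_
    ⟨1, 0, rfl, hs⟩
  · rintro K s ⟨k, a, hK, H⟩
    simp [H.size, H.k_eq]
    omega
  · rintro K s ⟨k, a, hK, H⟩ hb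
    obtain ⟨size, nodes, pos, lo, g_eq, sol, hi_mul_le, last, k_eq, k_le,
      clusters, r7, r8⟩ := H
    simp only [Test.Holds, NExpr.eval, k_eq, size] at hb
    have e1 : k < S := by omega
    have e2 := clusters.last_lt hg
    have e3 : a + 1 < S := by omega
    have e4 := clusters.ix_lt a le_rfl
    have e5 : a < S := by omega
    have e6 : s.natArr 0 a < S := by omega
    have e8 : 1 ≤ S := by omega
    simp [k_eq, g_eq, nodes, last, pos k (by omega), pos (s.natArr 0 a) (by omega), e1, e1.le, e3,
      e3.le, e5, e5.le, e6, e6.le, e8, r7, r8]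
    refine ⟨fun hle => ⟨K - 1, by omega, k + 1, by omega, a, ?_⟩, fun hlt => ⟨K - 1, by omega, k + 1,
      by omega, a + 1, ?_⟩⟩
    · have := clusters.step_old hle
      constructor <;> simp [*]
      exacts [pos, this]
    · have := clusters.step_new hg hlt
      constructor <;> simp [*]
      exacts [pos, this]
  · rintro K s ⟨k, a, hK, H⟩ hb
    simp only [Test.Holds, NExpr.eval, H.size, H.k_eq] at hb
    have := H.k_le
    obtain rfl : k = I.n + 1 := by omega
    exact ⟨a, H⟩

/-- After the second phase: the clusters, with the suffix maxima computed down to `k`. -/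
structure Suffixed (I : WDoap) (ε g : ℝ) (a k : ℕ) (s : State) : Prop where
  pos : ∀ l ≤ I.n, s.realArr 2 l = I.pos l
  lo : s.realReg 4 = 0
  g_eq : s.realReg 3 = g
  sol : Solution I I.len (s.natReg 1) (s.natReg 2) (s.realReg 5)
  hi_mul_le : ε * s.realReg 5 ≤ 64 * g
  last : s.natReg 5 = a
  k_eq : s.natReg 3 = k
  k_le : k ≤ a
  clusters : Clusters I g (I.n + 1) a (s.natArr 0) (s.realArr 3) (s.realArr 4)
  r8 : s.realReg 8 = s.realArr 4 k
  anti : ∀ b, k ≤ b → b < a → s.realArr 4 (b + 1) ≤ s.realArr 4 b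

theorem exec_suffixLoop (hS : I.n + 3 ≤ S) {g : ℝ} (hg : 0 ≤ g) {a : ℕ} {s : State}
    (hs : Suffixed I ε g a a s) :
    Exec I S suffixLoop s (suffixLoop.iter * (a + 1)) (Suffixed I ε g a 0) := by
  refine Exec.flatLoop (Suffixed I ε g a) ?_ ?_ ?_ hs
  · intro k s H
    have := H.k_le
    have := H.clusters.last_lt hg
    simp [H.k_eq]
    omega
  · intro k s H hb
    simp only [Test.Holds, NExpr.eval, H.k_eq] at hb
    obtain ⟨pos, lo, g_eq, sol, hi_mul_le, last, k_eq, k_le, clusters, r8, anti⟩ := H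
    have := clusters.last_lt hg
    obtain ⟨k, rfl⟩ : ∃ l, k = l + 1 := ⟨k - 1, by omega⟩
    have e1 : k < S := by omega
    have e2 : k + 1 ≤ S := by omega
    have e3 : 1 ≤ S := by omega
    simp [k_eq, e1, e1.le, e2, e3, r8]
    refine ⟨k, le_rfl, ?_⟩
    have h1 := clusters.step_suffix hg k_le
    have h2 := antitone_step_suffix anti
    constructor <;> try simp [*]
    exacts [pos, by omega, h2]
  · intro k s H hb
    simp only [Test.Holds, NExpr.eval, H.k_eq] at hb
    obtain rfl : k = 0 := by omega
    exact H

end RealRAM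

namespace RealRAM

open WDoap

variable {I : WDoap} {S : ℕ} {g : ℝ} {a : ℕ} {ix : ℕ → ℕ} {P U : ℕ → ℝ}

/-! ## Correctness: the binary search -/

/-- The clusters as computed by the program. -/
structure Table (I : WDoap) (g : ℝ) (a : ℕ) (ix : ℕ → ℕ) (P U : ℕ → ℝ) : Prop where
  nonneg : 0 ≤ g
  clusters : Clusters I g (I.n + 1) a ix P U
  anti : ∀ b b', b ≤ b' → b' ≤ a → U b' ≤ U b

/-- The clusters are stored in memory. -/
structure Stored (I : WDoap) (g : ℝ) (a : ℕ) (ix : ℕ → ℕ) (P U : ℕ → ℝ) (s : State) : Prop where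
  g_eq : s.realReg 3 = g
  last : s.natReg 5 = a
  ix : s.natArr 0 = ix
  pos : ∀ l ≤ I.n, s.realArr 2 l = I.pos l
  P : s.realArr 3 = P
  U : s.realArr 4 = U

/-- The loop invariant of the first part of the test for `μ`. -/
structure CornerInv (I : WDoap) (g : ℝ) (a : ℕ) (ix : ℕ → ℕ) (P U : ℕ → ℝ) (i j : ℕ)
    (lo hi μ : ℝ) (k h : ℕ) (s : State) : Prop where
  stored : Stored I g a ix P U s
  i_eq : s.natReg 1 = i
  j_eq : s.natReg 2 = j
  lo : s.realReg 4 = lo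
  hi : s.realReg 5 = hi
  mu : s.realReg 6 = μ
  k_eq : s.natReg 3 = k
  h_eq : s.natReg 4 = h
  k_le : k ≤ a + 1
  h_le : h ≤ a + 1
  corners : Corners a k P U μ (s.realReg 9) (s.realReg 10) (s.realReg 11) (s.realReg 12)
  close : ∀ h' < h, ∀ k', k ≤ k' → k' ≤ a → P h' + U k' ≤ μ

/-- The result of the first part of the test for `μ`. -/
structure CornerPost (I : WDoap) (g : ℝ) (a : ℕ) (ix : ℕ → ℕ) (P U : ℕ → ℝ) (i j : ℕ)
    (lo hi μ : ℝ) (s : State) : Prop where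
  stored : Stored I g a ix P U s
  i_eq : s.natReg 1 = i
  j_eq : s.natReg 2 = j
  lo : s.realReg 4 = lo
  hi : s.realReg 5 = hi
  mu : s.realReg 6 = μ
  corners : Corners a (a + 1) P U μ (s.realReg 9) (s.realReg 10) (s.realReg 11) (s.realReg 12)

theorem exec_cornerInit (hS : I.n + 3 ≤ S) (T : Table I g a ix P U) {i j : ℕ} {lo hi : ℝ}
    {s : State} (hs : Stored I g a ix P U s) (hi' : s.natReg 1 = i) (hj : s.natReg 2 = j)
    (hlo : s.realReg 4 = lo) (hhi : s.realReg 5 = hi) (hμ : (lo + hi) / 2 < I.len) :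
    Exec I S cornerInit s cornerInit.bound
      (CornerInv I g a ix P U i j lo hi ((lo + hi) / 2) 0 0) := by
  apply Exec.of_wp
  obtain ⟨g_eq, last, ix, pos, P_eq, U_eq⟩ := hs
  have := T.clusters.last_lt T.nonneg
  have e1 : a < S := by omega
  have e2 : 0 < S := by omega
  have h1 : (lo + hi) / 2 < P a + U 0 := hμ.trans_le (T.clusters.len_le T.anti)
  simp [cornerInit, *, e1.le]
  have h2 := Corners.init a P U h1
  constructor <;> try simp [*]
  constructor <;> try simp [*]
  exact pos

/-- `P` increases and `U` decreases along the clusters, so the first partner too far from `k` moves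
right as `k` does. Every iteration advances one of the two pointers, hence at most `2 * (a + 1)`
iterations. -/
theorem exec_cornerLoop (hS : I.n + 3 ≤ S) (T : Table I g a ix P U) {i j : ℕ} {lo hi μ : ℝ}
    {s : State} (hs : CornerInv I g a ix P U i j lo hi μ 0 0 s) :
    Exec I S cornerLoop s (cornerLoop.iter * (2 * (a + 1) + 1))
      (CornerPost I g a ix P U i j lo hi μ) := by
  refine Exec.flatLoop (fun K s => ∃ k h, K + k + h = 2 * (a + 1) ∧
    CornerInv I g a ix P U i j lo hi μ k h s) ?_ ?_ ?_ ⟨0, 0, rfl, hs⟩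
  · rintro K s ⟨k, h, hK, H⟩
    have := H.k_le
    have := H.h_le
    have := T.clusters.last_lt T.nonneg
    simp [H.k_eq, H.h_eq, H.stored.last]
    omega
  · rintro K s ⟨k, h, hK, H⟩ hb
    simp only [Test.Holds, NExpr.eval, H.k_eq, H.h_eq, H.stored.last] at hb
    obtain ⟨⟨g_eq, last, ix, pos, P_eq, U_eq⟩, i_eq, j_eq, lo, hi, mu, k_eq, h_eq, k_le, h_le,
      corners, close⟩ := H
    have := T.clusters.last_lt T.nonneg
    have e1 : k < S := by omega
    have e2 : h < S := by omega
    have e3 : a < S := by omega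
    have e4 : k + 1 ≤ S := by omega
    have e5 : h + 1 ≤ S := by omega
    have e6 : 1 ≤ S := by omega
    simp [k_eq, h_eq, last, P_eq, U_eq, mu, e1, e1.le, e2, e2.le, e3, e3.le, e6]
    refine ⟨fun hle => ⟨K - 1, by omega, k, h + 1, by omega, ?_⟩, fun hlt => ⟨K - 1, by omega, k + 1,
      h, by omega, ?_⟩⟩
    · have hc : ∀ h' < h + 1, ∀ k', k ≤ k' → k' ≤ a → P h' + U k' ≤ μ := by
        intro h' hh k' hk hk'
        rcases Nat.lt_succ_iff_lt_or_eq.1 hh with h1 | rfl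
        · exact close h' h1 k' hk hk'
        · linarith [T.anti k k' hk hk']
      refine ⟨?_, ?_, ?_, ?_, ?_, ?_, ?_, ?_, ?_, ?_, ?_, hc⟩
      · constructor <;> try simp [*]
        exact pos
      all_goals simp [*]
    · have hc := corners.step (fun h hh => T.clusters.P_mono hh le_rfl) T.anti hb.1 hb.2
        (fun h' hh => close h' hh k le_rfl hb.1) hlt
      have hc' : ∀ h' < h, ∀ k', k + 1 ≤ k' → k' ≤ a → P h' + U k' ≤ μ :=
        fun h' hh k' hk hk' => close h' hh k' (by omega) hk'
      refine ⟨?_, ?_, ?_, ?_, ?_, ?_, ?_, ?_, ?_, ?_, ?_, hc'⟩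
      · constructor <;> try simp [*]
        exact pos
      all_goals simp [*]
  · rintro K s ⟨k, h, hK, H⟩ hb
    simp only [Test.Holds, NExpr.eval, H.k_eq, H.h_eq, H.stored.last] at hb
    refine ⟨H.stored, H.i_eq, H.j_eq, H.lo, H.hi, H.mu, H.corners.extend ?_⟩
    intro k' h' hk hk' hh
    -- When the loop stops with a row `k' ≤ a` left, `h` has passed `a`, so all remaining pairs are
    -- close.
    exact H.close h' (by omega) k' hk hk'

/-- The effect of a check; `C` says that the checked shortcut is good. -/
structure Checked (I : WDoap) (c μ : ℝ) (C : Prop) (s s' : State) : Prop where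
  natReg : ∀ x, x ≠ 1 → x ≠ 2 → s'.natReg x = s.natReg x
  realReg : ∀ x, x ≠ 5 → s'.realReg x = s.realReg x
  natArr : s'.natArr = s.natArr
  realArr : s'.realArr = s.realArr
  sol : Solution I c (s'.natReg 1) (s'.natReg 2) (s'.realReg 5)
  mono : s.realReg 5 ≤ μ → s'.realReg 5 ≤ μ
  good : C → s'.realReg 5 ≤ μ

theorem Checked.stored {c μ : ℝ} {C : Prop} {s s' : State} (H : Checked I c μ C s s')
    (hs : Stored I g a ix P U s) : Stored I g a ix P U s' where
  g_eq := by rw [H.realReg 3 (by decide), hs.g_eq]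
  last := by rw [H.natReg 5 (by decide) (by decide), hs.last]
  ix := by rw [H.natArr, hs.ix]
  pos := by rw [H.realArr]; exact hs.pos
  P := by rw [H.realArr, hs.P]
  U := by rw [H.realArr, hs.U]

/-- The score of the shortcut between the first vertices of two clusters. -/
noncomputable abbrev repScore (I : WDoap) (ix : ℕ → ℕ) (pp pm mp mm : ℝ) (r j : ℕ) : ℝ :=
  score pp pm mp mm (I.cost (ix r) (ix j)) (I.pos (ix r)) (I.pos (ix j))

/-- The program evaluates `e` again after overwriting register `1`, which is why `e` must keep its
value in that state. -/
theorem wp_check (hS : I.n + 3 ≤ S) (T : Table I g a ix P U) {e : NExpr} {s : State}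
    {Q : State → Prop} {r j : ℕ} {c μ pp pm mp mm : ℝ} (hs : Stored I g a ix P U s)
    (hC : Corners a (a + 1) P U μ pp pm mp mm) (hr : r ≤ a) (h6 : s.natReg 6 = r)
    (hμ : s.realReg 6 = μ) (hμ' : μ ≤ c)
    (h13 : s.realReg 13 = max (pp - I.pos (ix r)) (mp + I.pos (ix r)))
    (h14 : s.realReg 14 = max (pm - I.pos (ix r)) (mm + I.pos (ix r)))
    (he : e.Safe S s) (hj : e.eval s = j)
    (he' : e.Safe S (s.setNat 1 (ix r))) (hj' : e.eval (s.setNat 1 (ix r)) = j)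
    (hsol : Solution I c (s.natReg 1) (s.natReg 2) (s.realReg 5))
    (hQ : ∀ s', Checked I c μ (r < j ∧ j ≤ a ∧ repScore I ix pp pm mp mm r j ≤ μ) s s' → Q s') :
    wp I S (check e) Q s := by
  obtain ⟨g_eq, last, ix_eq, pos, P_eq, U_eq⟩ := hs
  have e0 := T.clusters.last_lt T.nonneg
  have e1 : r < S := by omega
  have e2 : r + 1 ≤ S := by omega
  have e3 : a ≤ S := by omega
  have e4 : 1 ≤ S := by omega
  have e5 := T.clusters.ix_lt r hr
  have e6 : ix r < S := by omega
  have hsc : repScore I ix pp pm mp mm r j ≤ μ ↔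
      answer I (ix r) (ix j) + (s.realReg 13 - I.pos (ix j)) ≤ μ ∧
      answer I (ix r) (ix j) + (s.realReg 14 + I.pos (ix j)) ≤ μ := by
    rw [repScore, score, ← max_add_add_left, max_le_iff, h13, h14]; rfl
  have hbad : ¬ (r < j ∧ j ≤ a ∧ repScore I ix pp pm mp mm r j ≤ μ) → Q s := fun h =>
    hQ s ⟨fun _ _ _ => rfl, fun _ _ => rfl, rfl, rfl, hsol, id, fun h' => absurd h' h⟩
  by_cases hja : j ≤ a
  · have e7 := T.clusters.ix_lt j hja
    have e8 : j < S := by omega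
    have e9 : ix j < S := by omega
    have hgood : r < j ∧ j ≤ a ∧ repScore I ix pp pm mp mm r j ≤ μ →
        Q (((s.setNat 1 (ix r)).setNat 2 (ix j)).setReal 5 μ) := by
      intro h
      refine hQ _ ⟨?_, ?_, rfl, rfl, ?_, ?_, ?_⟩
      · intro x h1 h2; simp [h1, h2]
      · intro x h1; simp [h1]
      · simp
        exact ⟨T.clusters.ix_lt_ix T.nonneg h.1 hja, by omega,
          T.clusters.DLe_of_forall (hC.score_le_iff.1 h.2.2), hμ'⟩
      · simp
      · simp
    simp [check, last, ix_eq, h6, hμ, he, hj, he', hj', e1, e1.le, e2, e3, e4, e5, e6.le, e7, e8, e9,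
      e9.le, WDoap.N, pos (ix j) (by omega)]
    exact ⟨fun h1 h2 h3 h4 => hgood ⟨h1, h2, hsc.2 ⟨h3, h4⟩⟩, fun h => hbad fun h' =>
      absurd (hsc.1 h'.2.2).2 (not_le.2 (h h'.1 h'.2.1 (hsc.1 h'.2.2).1))⟩
  · have e7 : ¬ j ≤ a := hja
    have e8 : ¬ (r < j ∧ j ≤ a ∧ repScore I ix pp pm mp mm r j ≤ μ) := fun h => hja h.2.1
    -- The range test fails first, so the array and the oracle are never accessed with the bad
    -- index.
    simp [check, last, ix_eq, h6, he, hj, e1, e1.le, e2, e3, e4, hja, hbad e8]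

/-- The row that is treated at time `t`: the order is such that thresholds increase. -/
noncomputable def rowAt (pp pm mp mm : ℝ) (a t : ℕ) : ℕ :=
  open Classical in if pp + mm ≤ pm + mp then t else a - t

/-- The entries of a row before its threshold. -/
def Below (pp pm mp mm x y : ℝ) : Prop :=
  max (pm - x) (mm + x) + (y + y) ≤ max (pp - x) (mp + x)

/-- `rowAt` reverses the order of the rows exactly when thresholds would otherwise decrease. -/
theorem Below.mono (T : Table I g a ix P U) {pp pm mp mm y : ℝ} {t t' : ℕ} (h : t ≤ t')
    (h' : t' ≤ a) (H : Below pp pm mp mm (I.pos (ix (rowAt pp pm mp mm a t))) y) :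
    Below pp pm mp mm (I.pos (ix (rowAt pp pm mp mm a t'))) y := by
  refine threshold_mono ?_ H
  unfold rowAt
  split_ifs with hc
  · exact .inl ⟨hc, I.pos_mono (T.clusters.ix_mono T.nonneg h h')⟩
  · exact .inr ⟨(not_le.1 hc).le, I.pos_mono (T.clusters.ix_mono T.nonneg (by omega) (by omega))⟩

/-- The loop invariant of the second part of the test for `μ`. -/
structure SearchInv (I : WDoap) (g : ℝ) (a : ℕ) (ix : ℕ → ℕ) (P U : ℕ → ℝ)
    (c lo μ pp pm mp mm : ℝ) (t b : ℕ) (s : State) : Prop where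
  stored : Stored I g a ix P U s
  lo : s.realReg 4 = lo
  mu : s.realReg 6 = μ
  r9 : s.realReg 9 = pp
  r10 : s.realReg 10 = pm
  r11 : s.realReg 11 = mp
  r12 : s.realReg 12 = mm
  t_eq : s.natReg 3 = t
  b_eq : s.natReg 4 = b
  t_le : t ≤ a + 1
  b_le : b ≤ a + 1
  sol : Solution I c (s.natReg 1) (s.natReg 2) (s.realReg 5)
  below : ∀ b' < b, ∀ t', t ≤ t' → t' ≤ a →
    Below pp pm mp mm (I.pos (ix (rowAt pp pm mp mm a t'))) (I.pos (ix b'))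
  done : ∀ t' < t, ∀ j, rowAt pp pm mp mm a t' < j → j ≤ a →
    repScore I ix pp pm mp mm (rowAt pp pm mp mm a t') j ≤ μ → s.realReg 5 ≤ μ

/-- The column pointer never moves back: columns below the threshold of one row stay below it for
all later rows. Hence each step either advances the column or finishes the row. -/
theorem wp_columnStep (hS : I.n + 3 ≤ S) (T : Table I g a ix P U) {c l₀ μ pp pm mp mm : ℝ}
    (hC : Corners a (a + 1) P U μ pp pm mp mm) (hμ' : μ ≤ c) {t b : ℕ} {s : State} {K r : ℕ}
    (hK : K + t + b = 2 * (a + 1)) (ht : t ≤ a) (hrow : rowAt pp pm mp mm a t = r)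
    (hs : SearchInv I g a ix P U c l₀ μ pp pm mp mm t b s) (h6 : s.natReg 6 = r)
    (h13 : s.realReg 13 = max (pp - I.pos (ix r)) (mp + I.pos (ix r)))
    (h14 : s.realReg 14 = max (pm - I.pos (ix r)) (mm + I.pos (ix r))) :
    wp I S columnStep (fun s => ∃ K' < K, ∃ t b, K' + t + b = 2 * (a + 1) ∧
      SearchInv I g a ix P U c l₀ μ pp pm mp mm t b s) s := by
  have hr : r ≤ a := by rw [← hrow]; unfold rowAt; split_ifs <;> omega
  have hs' := hs
  obtain ⟨⟨g_eq, last, ix_eq, pos, P_eq, U_eq⟩, lo, mu, r9, r10, r11, r12, t_eq, b_eq, t_le, b_le,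
    sol, below, done⟩ := hs
  have e0 := T.clusters.last_lt T.nonneg
  have e1 : b ≤ S := by omega
  have e2 : a ≤ S := by omega
  have e3 : 1 ≤ S := by omega
  have e4 : b + 1 ≤ S := by omega
  have e5 : ∀ b ≤ a, ix b ≤ I.n := fun b hb => Nat.lt_succ_iff.1 (T.clusters.ix_lt b hb)
  have e6 : b ≤ a → b < S := by omega
  have e7 : b ≤ a → ix b < S := fun h => by have := e5 b h; omega
  have hup : b ≤ a → Below pp pm mp mm (I.pos (ix r)) (I.pos (ix b)) →
      ∃ K' < K, ∃ t' b', K' + t' + b' = 2 * (a + 1) ∧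
        SearchInv I g a ix P U c l₀ μ pp pm mp mm t' b' (s.setNat 4 (b + 1)) := by
    intro hb hbel
    refine ⟨K - 1, by omega, t, b + 1, by omega, ?_⟩
    have hbelow : ∀ b' < b + 1, ∀ t', t ≤ t' → t' ≤ a →
        Below pp pm mp mm (I.pos (ix (rowAt pp pm mp mm a t'))) (I.pos (ix b')) := by
      intro b' hb' t' h1 h2
      rcases Nat.lt_succ_iff_lt_or_eq.1 hb' with h3 | rfl
      · exact below b' h3 t' h1 h2
      · exact Below.mono T h1 h2 (by rwa [hrow])
    refine ⟨?_, ?_, ?_, ?_, ?_, ?_, ?_, ?_, ?_, ?_, ?_, ?_, hbelow, ?_⟩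
    · constructor <;> try simp [*]
      exact pos
    all_goals first
      | exact done
      | simp [*]
  have hrow' : ¬ (b ≤ a ∧ Below pp pm mp mm (I.pos (ix r)) (I.pos (ix b))) →
      wp I S (.seq (check (.sub (.reg 4) (.lit 1))) <| .seq (check (.reg 4)) <|
    .seq (check (.add (.reg 6) (.lit 1))) <| .setNat 3 (.add (.reg 3) (.lit 1)))
      (fun s => ∃ K' < K, ∃ t b, K' + t + b = 2 * (a + 1) ∧
        SearchInv I g a ix P U c l₀ μ pp pm mp mm t b s) s := by
    intro hnb
    rw [wp]
    -- For `b = 0` the truncated subtraction gives column `0`, which fails the test `r < j`.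
    refine wp_check (j := b - 1) hS T hs'.stored hC hr h6 mu hμ' h13 h14 (by simp [b_eq, e1, e3])
      (by simp [b_eq]) (by simp [b_eq, e1, e3]) (by simp [b_eq]) sol fun s1 c1 => ?_
    rw [wp]
    have b1 : s1.natReg 4 = b := by rw [c1.natReg 4 (by decide) (by decide), b_eq]
    refine wp_check (j := b) hS T (c1.stored hs'.stored) hC hr
      (by rw [c1.natReg 6 (by decide) (by decide), h6]) (by rw [c1.realReg 6 (by decide), mu]) hμ'
      (by rw [c1.realReg 13 (by decide), h13]) (by rw [c1.realReg 14 (by decide), h14])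
      (by simp [b1, e1]) (by simp [b1]) (by simp [b1, e1]) (by simp [b1]) c1.sol fun s2 c2 => ?_
    rw [wp]
    have r2 : s2.natReg 6 = r := by
      rw [c2.natReg 6 (by decide) (by decide), c1.natReg 6 (by decide) (by decide), h6]
    have hrS : r + 1 ≤ S := by omega
    refine wp_check (j := r + 1) hS T (c2.stored (c1.stored hs'.stored)) hC hr r2
      (by rw [c2.realReg 6 (by decide), c1.realReg 6 (by decide), mu]) hμ'
      (by rw [c2.realReg 13 (by decide), c1.realReg 13 (by decide), h13])
      (by rw [c2.realReg 14 (by decide), c1.realReg 14 (by decide), h14])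
      (by simp [r2, e3, hrS]; omega) (by simp [r2]) (by simp [r2, e3, hrS]; omega) (by simp [r2])
      c2.sol fun s3 c3 => ?_
    have hn : ∀ x, x ≠ 1 → x ≠ 2 → s3.natReg x = s.natReg x := fun x h1 h2 => by
      rw [c3.natReg x h1 h2, c2.natReg x h1 h2, c1.natReg x h1 h2]
    have hr' : ∀ x, x ≠ 5 → s3.realReg x = s.realReg x := fun x h1 => by
      rw [c3.realReg x h1, c2.realReg x h1, c1.realReg x h1]
    have hm : s.realReg 5 ≤ μ → s3.realReg 5 ≤ μ := fun h => c3.mono (c2.mono (c1.mono h))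
    have hst := c3.stored (c2.stored (c1.stored hs'.stored))
    have ht1 : s3.natReg 3 = t := by rw [hn 3 (by decide) (by decide), t_eq]
    have e8 : t + 1 ≤ S := by omega
    have e9 : t ≤ S := by omega
    simp only [wp, NExpr.Safe, NExpr.eval, ht1]
    refine ⟨⟨e9, e3, e8⟩, K - 1, by omega, t + 1, b, by omega, ?_⟩
    have hdone : ∀ t' < t + 1, ∀ j, rowAt pp pm mp mm a t' < j → j ≤ a →
        repScore I ix pp pm mp mm (rowAt pp pm mp mm a t') j ≤ μ → s3.realReg 5 ≤ μ := by
      intro t' ht' j h1 h2 h3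
      rcases Nat.lt_succ_iff_lt_or_eq.1 ht' with h4 | rfl
      · exact hm (done t' h4 j h1 h2 h3)
      · rw [hrow] at h1 h3
        -- If any shortcut of this row is good, one of the three checked candidates is.
        obtain ⟨j', hj', h4, h5, h6⟩ := exists_score_le (X := fun k => I.pos (ix k))
          (C := fun k => I.cost (ix r) (ix k)) (b := b) (a := a)
          (fun k l hkl hl => I.pos_mono (T.clusters.ix_mono T.nonneg hkl hl))
          (by
            intro k l hrk hkl hl
            have g1 := T.clusters.ix_lt_ix T.nonneg hrk (hkl.trans hl)
            have g2 := T.clusters.ix_lt_ix T.nonneg (hrk.trans_le hkl) hl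
            have g3 := I.pos_mono (T.clusters.ix_mono T.nonneg hkl hl)
            have g4 := I.cost_le (e5 r hr) (e5 l hl) (e5 k (hkl.trans hl)) g2.ne g1.ne
            have g5 := I.cost_le (e5 r hr) (e5 k (hkl.trans hl)) (e5 l hl) g1.ne g2.ne
            rw [abs_of_nonneg (sub_nonneg.2 g3)] at g5
            rw [abs_sub_comm, abs_of_nonneg (sub_nonneg.2 g3)] at g4
            exact ⟨g4, g5⟩)
          b_le (fun b' hb' => hrow ▸ below b' hb' t' le_rfl ht)
          (fun hb => not_le.1 fun h => hnb ⟨hb, h⟩) h1 h2 h3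
        rcases hj' with rfl | rfl | rfl
        · exact c3.mono (c2.mono (c1.good ⟨h4, h5, h6⟩))
        · exact c3.mono (c2.good ⟨h4, h5, h6⟩)
        · exact c3.good ⟨h4, h5, h6⟩
    refine ⟨?_, ?_, ?_, ?_, ?_, ?_, ?_, ?_, ?_, ?_, ?_, ?_,
      fun b' hb' t' h1 h2 => below b' hb' t' (by omega) h2, ?_⟩
    · obtain ⟨q1, q2, q3, q4, q5, q6⟩ := hst
      constructor <;> try simp [*]
      exact q4
    all_goals try simp [*]
    · exact c3.sol
    · exact fun t' ht' => hdone t' (Nat.lt_succ_of_le ht')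
  rw [columnStep, wp]
  refine ⟨?_, fun h => ?_, fun h => ?_⟩
  · simp [b_eq, last, ix_eq, e1, e2]
    intro hb
    exact ⟨⟨e6 hb, (e7 hb).le⟩, e7 hb⟩
  · simp [b_eq, last, ix_eq, h14, h13, -le_sup_iff] at h
    rw [pos _ (e5 b h.1)] at h
    simp [b_eq, e1, e3, e4]
    exact hup h.1 h.2
  · apply hrow'
    rintro ⟨h1, h2⟩
    apply h
    simp [b_eq, last, ix_eq, h14, h13, h1, -le_sup_iff]
    rw [pos _ (e5 b h1)]
    exact h2

theorem wp_rowStep (hS : I.n + 3 ≤ S) (T : Table I g a ix P U) {c l₀ μ pp pm mp mm : ℝ} {t b : ℕ}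
    {s : State} (ht : t ≤ a) (hs : SearchInv I g a ix P U c l₀ μ pp pm mp mm t b s)
    {Q : State → Prop}
    (hQ : ∀ s' r, rowAt pp pm mp mm a t = r → SearchInv I g a ix P U c l₀ μ pp pm mp mm t b s' →
      s'.natReg 6 = r → s'.realReg 13 = max (pp - I.pos (ix r)) (mp + I.pos (ix r)) →
      s'.realReg 14 = max (pm - I.pos (ix r)) (mm + I.pos (ix r)) → Q s') :
    wp I S rowStep Q s := by
  obtain ⟨⟨g_eq, last, ix_eq, pos, P_eq, U_eq⟩, lo, mu, r9, r10, r11, r12, t_eq, b_eq, t_le, b_le,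
    sol, below, done⟩ := hs
  have e0 := T.clusters.last_lt T.nonneg
  have e1 : a ≤ S := by omega
  have e2 : t < S := by omega
  have e3 : a - t < S := by omega
  have e5 : ∀ b ≤ a, ix b ≤ I.n := fun b hb => Nat.lt_succ_iff.1 (T.clusters.ix_lt b hb)
  have e6 : ix t < S := by have := e5 t ht; omega
  have e7 : ix (a - t) < S := by have := e5 (a - t) (by omega); omega
  have p1 := pos _ (e5 t ht)
  have p2 := pos _ (e5 (a - t) (by omega))
  simp [rowStep, r9, r10, r11, r12, last, t_eq, ix_eq, e1, e2, e2.le, e3, e3.le, e6, e6.le, e7,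
    e7.le, p1, p2]
  refine ⟨fun h => hQ _ t (by simp [rowAt, h]) ?_ ?_ ?_ ?_,
    fun h => hQ _ (a - t) (by simp [rowAt, h]) ?_ ?_ ?_ ?_⟩
  all_goals try simp
  all_goals
    refine ⟨?_, ?_, ?_, ?_, ?_, ?_, ?_, ?_, ?_, ?_, ?_, ?_, below, ?_⟩
    · constructor <;> first
        | exact pos
        | simp [*]
    all_goals first
      | exact done
      | simp [*]

/-- A staircase walk: rows and columns together advance at most `2 * (a + 1)` times. -/
theorem exec_searchLoop (hS : I.n + 3 ≤ S) (T : Table I g a ix P U) {c l₀ μ pp pm mp mm : ℝ}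
    (hC : Corners a (a + 1) P U μ pp pm mp mm) (hμ' : μ ≤ c) {s : State}
    (hs : SearchInv I g a ix P U c l₀ μ pp pm mp mm 0 0 s) :
    Exec I S searchLoop s (searchLoop.iter * (2 * (a + 1) + 1))
      (fun s => ∃ b, SearchInv I g a ix P U c l₀ μ pp pm mp mm (a + 1) b s) := by
  refine Exec.flatLoop (fun K s => ∃ t b, K + t + b = 2 * (a + 1) ∧
    SearchInv I g a ix P U c l₀ μ pp pm mp mm t b s) ?_ ?_ ?_ ⟨0, 0, rfl, hs⟩
  · rintro K s ⟨t, b, hK, H⟩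
    have := H.t_le
    have := T.clusters.last_lt T.nonneg
    simp [H.t_eq, H.stored.last]
    omega
  · rintro K s ⟨t, b, hK, H⟩ hb
    simp only [Test.Holds, NExpr.eval, H.t_eq, H.stored.last] at hb
    rw [wp]
    exact wp_rowStep hS T hb H fun s' r h1 h2 h3 h4 h5 =>
      wp_columnStep hS T hC hμ' hK hb h1 h2 h3 h4 h5
  · rintro K s ⟨t, b, hK, H⟩ hb
    simp only [Test.Holds, NExpr.eval, H.t_eq, H.stored.last] at hb
    have := H.t_le
    obtain rfl : t = a + 1 := by omega
    exact ⟨b, H⟩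

/-- If the search for a shortcut of value `μ` fails, then `μ` is almost a lower bound. -/
theorem le_of_search_fails (T : Table I g a ix P U) {c l₀ μ pp pm mp mm : ℝ}
    (hC : Corners a (a + 1) P U μ pp pm mp mm) (hμ' : μ ≤ I.len) {b : ℕ} {s : State}
    (H : SearchInv I g a ix P U c l₀ μ pp pm mp mm (a + 1) b s) (hf : ¬ s.realReg 5 ≤ μ) {i j : ℕ}
    {ν : ℝ} (hij : i < j) (hj : j ≤ I.n) (hν : I.DLe i j ν) : μ ≤ ν + 6 * g := by
  have hg := T.nonneg
  rcases T.clusters.exists_of_DLe hg hij hj hν with h | ⟨r, q, hrq, hq, h⟩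
  -- Here the optimum is within `g` of the length of the path, which is at least `μ`.
  · linarith
  · by_contra hlt
    push Not at hlt
    apply hf
    obtain ⟨t, ht, hr⟩ : ∃ t < a + 1, rowAt pp pm mp mm a t = r := by
      unfold rowAt
      split_ifs
      · exact ⟨r, by omega, rfl⟩
      · exact ⟨a - r, by omega, by omega⟩
    refine H.done t ht q (by omega) hq ?_
    rw [hr]
    refine hC.score_le_iff.2 fun k l hk hl => ?_
    rcases h k l hk hl with h1 | h1
    · left; linarith
    · right; linarith

/-- The loop invariant of the binary search. -/
structure BisectInv (I : WDoap) (g : ℝ) (a : ℕ) (ix : ℕ → ℕ) (P U : ℕ → ℝ) (K : ℕ)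
    (s : State) : Prop where
  stored : Stored I g a ix P U s
  sol : Solution I I.len (s.natReg 1) (s.natReg 2) (s.realReg 5)
  lower : ∀ i j μ, i < j → j ≤ I.n → I.DLe i j μ → s.realReg 4 ≤ μ + 6 * g
  gap : s.realReg 5 - s.realReg 4 ≤ g * 2 ^ K

/-- An upper bound on the cost of one iteration of the binary search with `a + 1` clusters. -/
def bisectCost (a : ℕ) : ℕ :=
  (cornerInit.bound + cornerLoop.iter + searchLoop.iter + 100) * (2 * (a + 1) + 1)

/-- Each test halves the gap: success lowers the upper bound to the midpoint or below, and failure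
makes the midpoint a lower bound up to `6 g`. The final gap `g` accounts for the seventh. -/
theorem exec_bisectLoop (hS : I.n + 3 ≤ S) (T : Table I g a ix P U) {K : ℕ} {s : State}
    (hs : BisectInv I g a ix P U K s) :
    Exec I S bisectLoop s ((bisectCost a + 20) * (K + 1)) (fun s =>
      Solution I I.len (s.natReg 1) (s.natReg 2) (s.realReg 5) ∧
      ∀ i j μ, i < j → j ≤ I.n → I.DLe i j μ → s.realReg 5 ≤ μ + 7 * g) := by
  refine (Exec.loop (C := bisectCost a) (BisectInv I g a ix P U) ?_ ?_ ?_ hs).mono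
    (Nat.mul_le_mul_right _ ?_) fun _ h => h
  · intro K s H
    simp
  · intro K s H hb
    simp [H.stored.g_eq] at hb
    have hgap := H.gap
    obtain ⟨K, rfl⟩ : ∃ L, K = L + 1 := by
      refine ⟨K - 1, ?_⟩
      by_contra hcon
      obtain rfl : K = 0 := by omega
      -- For `K = 0` the gap is at most `g` already, contrary to the loop test.
      linarith
    have hg := T.nonneg
    have hmid : (s.realReg 4 + s.realReg 5) / 2 < s.realReg 5 := by linarith
    have hlen : (s.realReg 4 + s.realReg 5) / 2 < I.len := hmid.trans_le H.sol.le
    refine (Exec.seq (exec_cornerInit hS T H.stored rfl rfl rfl rfl hlen) fun s1 h1 =>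
      Exec.seq (exec_cornerLoop hS T h1) fun s2 h2 =>
      -- Taking the current upper bound for `c` ensures that the search never worsens the recorded
      -- solution.
      Exec.seq (R := SearchInv I g a ix P U (s.realReg 5) (s.realReg 4) ((s.realReg 4 + s.realReg 5) / 2)
        (s2.realReg 9) (s2.realReg 10) (s2.realReg 11) (s2.realReg 12) 0 0) (Exec.of_wp ?_)
        fun s3 h3 => Exec.seq (exec_searchLoop hS T h2.corners hmid.le h3) fun s4 h4 =>
          Exec.of_wp ?_).mono (T := _) ?_ fun _ h => h
    · have e3 : 0 ≤ S := by omega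
      simp
      obtain ⟨⟨g_eq, last, ix_eq, pos, P_eq, U_eq⟩, i_eq, j_eq, lo, hi, mu, corners⟩ := h2
      refine ⟨?_, ?_, ?_, ?_, ?_, ?_, ?_, ?_, ?_, ?_, ?_, ?_, ?_, ?_⟩
      · constructor <;> first
          | exact pos
          | simp [*]
      all_goals simp [*]
      obtain ⟨h1, h2, h3, -⟩ := H.sol
      exact ⟨h1, h2, h3, le_rfl⟩
    · obtain ⟨b, h4⟩ := h4
      have hst := h4.stored
      obtain ⟨q1, q2, q3, q4⟩ := h4.sol
      have hhalf : g * 2 ^ (K + 1) = 2 * (g * 2 ^ K) := by ring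
      have hsol : Solution I I.len (s4.natReg 1) (s4.natReg 2) (s4.realReg 5) :=
        ⟨q1, q2, q3, q4.trans H.sol.le⟩
      simp [h4.mu]
      refine ⟨fun hle => ⟨K, Nat.le_refl K, hst, hsol, ?_, ?_⟩,
        fun hlt => ⟨K, Nat.le_refl K, ?_, ?_, ?_, ?_⟩⟩
      · rw [h4.lo]; exact H.lower
      · rw [h4.lo]; linarith
      · obtain ⟨g_eq, last, ix_eq, pos, P_eq, U_eq⟩ := hst
        constructor <;> first
          | exact pos
          | simp [*]
      · simpa using hsol
      · intro i j ν hij hj hν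
        simp
        exact le_of_search_fails T h2.corners hlen.le h4 (not_le.2 hlt) hij hj hν
      · simp; linarith
    · simp only [bisectCost, Prog.bound, NExpr.steps, RExpr.steps, Test.steps]
      generalize cornerInit.bound = A
      have h1 : A ≤ A * (2 * (a + 1) + 1) := Nat.le_mul_of_pos_right _ (by omega)
      rw [add_mul, add_mul, add_mul]
      omega
  · intro K s H hb
    simp [H.stored.g_eq] at hb
    refine ⟨H.sol, fun i j μ hij hj hμ => ?_⟩
    linarith [H.lower i j μ hij hj hμ]
  · simp [Test.steps, RExpr.steps]

end RealRAM

namespace RealRAM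

open WDoap

variable {I : WDoap} {S : ℕ} {ε : ℝ}

/-! ## Correctness and running time of the algorithm -/

/-- The cost of the algorithm per vertex, except for the binary search. -/
def linearCost : ℕ :=
  scanLoop.iter + estimateStep.bound + clusterLoop.iter + suffixLoop.iter + 10

/-- The cost of the binary search per iteration and cluster. -/
def searchCost : ℕ :=
  3 * (cornerInit.bound + cornerLoop.iter + searchLoop.iter + 120)

theorem bisectCost_le (a : ℕ) : bisectCost a + 20 ≤ searchCost * (a + 1) := by
  rw [bisectCost, searchCost]
  generalize cornerInit.bound + cornerLoop.iter + searchLoop.iter = A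
  nlinarith

theorem scanned_input (hS : I.n + 3 ≤ S) : Exec I S (.setReal 2 (.get 0 (.lit 0))) (input I ε)
    (Prog.setReal 2 (.get 0 (.lit 0))).bound (Scanned I ε 0) := by
  apply Exec.of_wp
  have h : (input I ε).realArr 0 0 = I.edgeWt 0 := rfl
  have e1 : 0 < S := by omega
  have h1 : (input I ε).natReg 1 = 0 := rfl
  have h2 : (input I ε).natReg 3 = 0 := rfl
  have h3 : (input I ε).realReg 1 = 0 := rfl
  have h4 : (input I ε).realArr 2 0 = 0 := rfl
  have hn : 0 < I.n := I.one_le_n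
  simp [e1, h]
  obtain ⟨size, eps, edges, nodes, last, lo, r7, r8, ix, P, U⟩ := fresh_input (I := I) (ε := ε)
  refine ⟨?_, ?_, ?_, ?_, ?_, ?_, ?_, ?_⟩
  · constructor <;> simp [*]
  all_goals simp [*]

/-- For positive `g`, divide the cluster bound by `g`. For `g = 0` the path has a single edge, so `a
≤ 1`. -/
theorem last_mul_eps_le (hε : 0 < ε) {g : ℝ} (hG : GoodSize I ε g) {a : ℕ} {ix : ℕ → ℕ}
    {P U : ℕ → ℝ} (hC : Clusters I g (I.n + 1) a ix P U) : a * ε ≤ 64 + ε := by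
  obtain ⟨m, hm, h⟩ := hG.ge
  have h1 := hC.last_mul_le hG.nonneg m hm
  have h2 := hC.last_lt hG.nonneg
  rcases hG.nonneg.eq_or_lt with h0 | h0
  · have := hG.zero h0.symm
    have h3 : (a : ℝ) ≤ 1 := by exact_mod_cast (by omega : a ≤ 1)
    nlinarith
  · have h3 : a * g * ε ≤ (I.rest m + g) * ε := mul_le_mul_of_nonneg_right h1 hε.le
    have h4 : g * (a * ε) ≤ g * (64 + ε) := by linarith
    exact le_of_mul_le_mul_left h4 h0

/-- The algorithm solves the problem; `a + 1` is the number of clusters. -/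
theorem exec_algorithm (hS : I.n + 3 ≤ S) (hε : 0 < ε) {K : ℕ} (hK : 64 ≤ ε * 2 ^ K) :
    ∃ a : ℕ, a < I.n + 1 ∧ a * ε ≤ 64 + ε ∧
      Exec I S algorithm (input I ε)
        (linearCost * (I.n + 1) + searchCost * ((a + 1) * (K + 1)))
        (fun s => ∃ i j : Fin (I.n + 1), s.natReg 1 = i ∧ s.natReg 2 = j ∧
          I.IsApprox (1 + ε) i j) := by
  obtain ⟨s1, t1, r1, b1, h1⟩ := scanned_input (I := I) (ε := ε) hS
  obtain ⟨s2, t2, r2, b2, h2⟩ := exec_scanLoop hS h1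
  obtain ⟨s3, t3, r3, b3, g, hG, h3⟩ := exec_estimateStep hS hε h2
  obtain ⟨s4, t4, r4, b4, a, h4⟩ := exec_clusterLoop hS hG.nonneg h3
  have ha := h4.clusters.last_lt hG.nonneg
  have h5 : Exec I S (.setNat 3 (.reg 5)) s4 (Prog.setNat 3 (.reg 5)).bound
      (Suffixed I ε g a a) := by
    apply Exec.of_wp
    have e1 : a ≤ S := by omega
    simp [h4.last, e1]
    obtain ⟨size, nodes, pos, lo, g_eq, sol, hi_mul_le, last, k_eq, k_le, clusters, r7, r8⟩ := h4
    constructor <;> first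
      | exact pos
      | simp [*]
    intro b hb hb'
    omega
  obtain ⟨s5, t5, r5, b5, h5⟩ := h5
  obtain ⟨s6, t6, r6, b6, h6⟩ := exec_suffixLoop hS hG.nonneg h5
  have T : Table I g a (s6.natArr 0) (s6.realArr 3) (s6.realArr 4) :=
    ⟨hG.nonneg, h6.clusters, fun b b' h h' =>
      antitone_of_step (fun b hb => h6.anti b (Nat.zero_le _) hb) h h'⟩
  have hB : BisectInv I g a (s6.natArr 0) (s6.realArr 3) (s6.realArr 4) K s6 := by
    refine ⟨⟨h6.g_eq, h6.last, rfl, h6.pos, rfl, rfl⟩, h6.sol, ?_, ?_⟩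
    · intro i j μ hij hj hμ
      rw [h6.lo]
      linarith [hμ.nonneg, hG.nonneg]
    -- The upper bound times `ε` is at most `64 g`, and `64 ≤ ε * 2 ^ K`, so the initial gap is at
    -- most `g * 2 ^ K`.
    · have h7 := h6.sol.bound.nonneg
      have h8 := mul_le_mul_of_nonneg_left hK h7
      have h9 : ε * s6.realReg 5 * 2 ^ K ≤ 64 * g * 2 ^ K :=
        mul_le_mul_of_nonneg_right h6.hi_mul_le (by positivity)
      rw [h6.lo]
      linarith
  obtain ⟨s7, t7, r7, b7, h7, h8⟩ := exec_bisectLoop hS T hB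
  refine ⟨a, ha, last_mul_eps_le hε hG h4.clusters, s7, _,
    .seq r1 (.seq r2 (.seq r3 (.seq r4 (.seq r5 (.seq r6 r7))))), ?_, ?_⟩
  · have e1 : t6 ≤ suffixLoop.iter * (I.n + 1) := b6.trans (Nat.mul_le_mul_left _ (by omega))
    have e2 : t3 ≤ estimateStep.bound * (I.n + 1) := b3.trans (Nat.le_mul_of_pos_right _ (by omega))
    have e3 : t7 ≤ searchCost * ((a + 1) * (K + 1)) := by
      rw [← mul_assoc]
      exact b7.trans (Nat.mul_le_mul_right _ (bisectCost_le a))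
    have e4 : linearCost * (I.n + 1) = scanLoop.iter * (I.n + 1) + estimateStep.bound * (I.n + 1) +
        clusterLoop.iter * (I.n + 1) + suffixLoop.iter * (I.n + 1) + 10 * (I.n + 1) := by
      unfold linearCost; ring
    simp only [Prog.bound, NExpr.steps, RExpr.steps] at b1 b5
    omega
  · have hlt := h7.lt
    have hle := h7.le_n
    refine ⟨⟨s7.natReg 1, by omega⟩, ⟨s7.natReg 2, by omega⟩, rfl, rfl, hlt, ?_⟩
    intro i' j' hij
    have e1 := (I.D_le_iff (i := ⟨s7.natReg 1, by omega⟩) (j := ⟨s7.natReg 2, by omega⟩)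
      hlt).2 h7.bound
    have e2 := (I.D_le_iff hij).1 le_rfl
    have hj' : (j' : ℕ) ≤ I.n := Nat.lt_succ_iff.1 j'.2
    -- The additive error `7 g` becomes the relative error `ε` through the choice of the cluster
    -- size.
    have e3 := h8 i' j' _ hij hj' e2
    have e4 := hG.le i' j' _ hij hj' e2
    linarith

/-- The number of iterations of the binary search. -/
noncomputable def rounds (ε : ℝ) : ℕ := ⌈Real.log (64 / ε) / Real.log 2⌉₊

theorem le_mul_two_pow_rounds (hε : 0 < ε) : 64 ≤ ε * 2 ^ rounds ε := by
  have h2 : 0 < Real.log 2 := Real.log_pos (by norm_num)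
  have h1 : Real.log (64 / ε) ≤ rounds ε * Real.log 2 :=
    (div_le_iff₀ h2).1 (Nat.le_ceil _)
  rw [← Real.log_pow, Real.log_le_log_iff (by positivity) (by positivity), div_le_iff₀ hε] at h1
  linarith

/-- `64 = 2 ^ 6` contributes `6`, rounding up contributes `1`, and `log 2 > 1 / 2` gives the factor
`2`. -/
theorem rounds_le (hε : 0 < ε) {l : ℝ} (hl : 0 ≤ l) (h : Real.log (1 / ε) ≤ l) :
    (rounds ε : ℝ) ≤ 7 + 2 * l := by
  have h2 : 1 / 2 < Real.log 2 := by linarith [Real.log_two_gt_d9]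
  have h3 : Real.log (64 / ε) = 6 * Real.log 2 + Real.log (1 / ε) := by
    rw [div_eq_mul_one_div, Real.log_mul (by norm_num) (by positivity),
      show (64 : ℝ) = 2 ^ 6 by norm_num, Real.log_pow]
    norm_num
  have h4 : Real.log (64 / ε) / Real.log 2 ≤ 6 + 2 * l := by
    rw [div_le_iff₀ (by linarith), h3]
    nlinarith
  have h5 : (rounds ε : ℝ) ≤ ⌈6 + 2 * l⌉₊ := by exact_mod_cast Nat.ceil_mono h4
  linarith [Nat.ceil_lt_add_one (show 0 ≤ 6 + 2 * l by linarith)]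

/-- For `ε > 1` the logarithmic term of the time bound is negative. This bound lets the number of
vertices absorb it. -/
theorem neg_one_le_mul_log {y : ℝ} (hy : 0 < y) : -1 ≤ y * Real.log y := by
  have h1 := Real.one_sub_inv_le_log_of_pos hy
  have h2 := mul_le_mul_of_nonneg_left h1 hy.le
  rw [mul_sub, mul_inv_cancel₀ hy.ne'] at h2
  linarith

/-- The total cost of the binary search. -/
theorem search_cost_le (hε : 0 < ε) {a n : ℕ} (ha : a < n + 1) (hn : 1 ≤ n) (haε : a * ε ≤ 64 + ε) :
    ((a + 1) * (rounds ε + 1) : ℝ) ≤ 1000 * ((n + 1 : ℝ) + 1 / ε * Real.log (1 / ε)) := by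
  have hy : 0 < 1 / ε := by positivity
  have h1 := neg_one_le_mul_log hy
  have ha' : (a : ℝ) ≤ n := by exact_mod_cast Nat.lt_succ_iff.1 ha
  have hn' : (1 : ℝ) ≤ n := by exact_mod_cast hn
  have ha0 : (0 : ℝ) ≤ a := by positivity
  -- If the logarithm is at most `1`, there are at most `9` rounds and `a ≤ n` suffices. Otherwise
  -- `a + 1` is `O(1/ε)` and the number of rounds is `O(log (1/ε))`.
  rcases le_or_gt (Real.log (1 / ε)) 1 with hl | hl
  · have h2 := rounds_le hε zero_le_one hl
    nlinarith
  · have h2 := rounds_le hε (by linarith) le_rfl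
    have h3 : (a : ℝ) ≤ 64 * (1 / ε) + 1 := by
      rw [mul_one_div, ← sub_le_iff_le_add, le_div_iff₀ hε]; linarith
    have h4 : 1 ≤ 1 / ε := by
      by_contra hcon
      have := Real.log_nonpos hy.le (not_le.1 hcon).le
      linarith
    set y := 1 / ε
    set l := Real.log y
    have h5 : (a : ℝ) + 1 ≤ 66 * y := by linarith
    have h6 : (rounds ε : ℝ) + 1 ≤ 10 * l := by linarith
    have h7 : ((a : ℝ) + 1) * (rounds ε + 1) ≤ 66 * y * (10 * l) :=
      mul_le_mul h5 h6 (by positivity) (by positivity)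
    have h8 : 0 < y * l := by positivity
    linarith

end RealRAM

theorem mainTheorem5 :
    ∃ (p : RealRAM.Prog) (K : ℝ), ∀ (I : WDoap) (ε : ℝ), 0 < ε →
      RealRAM.Solves p I ε (K * (I.N + 1 / ε * Real.log (1 / ε))) ⌊K * (I.N + 1 / ε)⌋₊ := by
  -- The summand `3` provides the `n + 3` cells, since `n + 3 ≤ 3 * (n + 1)`; `1000` comes from
  -- `search_cost_le`.
  refine ⟨RealRAM.algorithm, 2 * RealRAM.linearCost + 1000 * RealRAM.searchCost + 3, ?_⟩
  intro I ε hε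
  set L : ℝ := ((RealRAM.linearCost : ℕ) : ℝ) with hL
  set C : ℝ := ((RealRAM.searchCost : ℕ) : ℝ) with hC
  have hL0 : 0 ≤ L := Nat.cast_nonneg _
  have hC0 : 0 ≤ C := Nat.cast_nonneg _
  have hn : (1 : ℝ) ≤ I.n := by exact_mod_cast I.one_le_n
  have hy : 0 < 1 / ε := by positivity
  have hN : (I.N : ℝ) = I.n + 1 := by simp [WDoap.N]
  have hS : I.n + 3 ≤ ⌊(2 * L + 1000 * C + 3) * (I.N + 1 / ε)⌋₊ := by
    apply Nat.le_floor
    push_cast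
    rw [hN]
    nlinarith [mul_nonneg hL0 hy.le, mul_nonneg hC0 hy.le]
  obtain ⟨a, ha, haε, s, t, hrun, ht, i, j, hi, hj, happ⟩ :=
    RealRAM.exec_algorithm hS hε (RealRAM.le_mul_two_pow_rounds hε)
  have hNS : I.N ≤ I.n + 3 := by unfold WDoap.N; omega
  refine ⟨hNS.trans hS, s, t, i, j, hrun, ?_, hi, hj, happ⟩
  have h1 : (t : ℝ) ≤ L * (I.n + 1) + C * ((a + 1) * (RealRAM.rounds ε + 1)) := by
    rw [hL, hC]; exact_mod_cast ht
  have h2 := mul_le_mul_of_nonneg_left (RealRAM.search_cost_le hε ha I.one_le_n haε) hC0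
  have h3 := RealRAM.neg_one_le_mul_log hy
  -- The factor `2` compensates for a logarithmic term as small as `-1`, because there are at least
  -- two vertices.
  have h4 : L * (I.n + 1) ≤ L * (2 * ((I.n + 1) + 1 / ε * Real.log (1 / ε))) :=
    mul_le_mul_of_nonneg_left (by linarith) hL0
  rw [hN]
  linarith
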